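/- Let $X$ be a trefoil space: a second-countable Hausdorff space with its Borel $\sigma$-algebra and a ($\sigma$-additive) Radon measure $\lambda$ (locally finite, inner regular with respect to compact sets). A measurable map $f:X\to X$ is non-singular measurable-preserving if for every measurable $A$ the set $f(A)$ is measurable, and $\lambda(f(A))=0$ if and only if $\lambda(A)=0$. A microcosm is a set of such maps that contains the identity and is closed under composition; the macrocosm $\mathfrak m$ is the microcosm of all such maps. Let $\Omega$ be a monoid. **Graphings.** A graphing in $\mathfrak m$ is a countable family $F=\{(\omega_e,\phi_e:S_e\to T_e)\}_{e\in E^F}$ with a measurable carrier $V^F$, where $\omega_e\in\Omega$, $S_e\subseteq V^F$ is measurable, $\phi_e$ is the restriction to $S_e$ of an element of $\mathfrak m$, and $T_e=\phi_e(S_e)\subseteq V^F$. The plugging of $F$ and $G$ is the disjoint union $F\uplus G$, with edges coloured by the graphing they come from. **Cycles.** A path is a non-empty finite sequence of edges $\pi=e_0\dots e_n$ with $\lambda(T_{e_i}\cap S_{e_{i+1}})>0$ for $0\le i<n$; it is a cycle if moreover $\lambda(S_{e_0}\cap T_{e_n})>0$. Write $\pi^k$ for the concatenation of $k$ copies of $\pi$.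 A $1$-cycle is a cycle that is not of the form $\rho^k$ with $\rho$ a cycle and $k>1$. A circuit is a class of cycles modulo cyclic permutation. An alternating cycle between $F$ and $G$ is a cycle of the plugging in which consecutive edges, and also the last and the first edge, have different colours. A choice of representatives of circuits for $(F,G)$ is a set $R_{F,G}$ of alternating cycles that contains exactly one element of each class of alternating cycles modulo cyclic permutation and such that $\pi^k\in R_{F,G}$ implies $\pi\in R_{F,G}$. **Refinements.** $(F',\theta)$ with $\theta:E^{F'}\to E^F$ is a refinement of $F$ if: for $e\ne e'$ with $\theta(e)=\theta(e')$, the sets $S_e\cap S_{e'}$ and $T_e\cap T_{e'}$ are null; $\omega_{\theta(e)}=\omega_e$; for every $f\in E^F$, up to null sets $S_f=\bigcup_{\theta(e)=f}S_e$ and $T_f=\bigcup_{\theta(e)=f}T_e$; and $\phi_{\theta(e)}=\phi_e$ almost everywhere on $S_{\theta(e)}\cap S_e$. It is simple if, for some $g\in E^F$, $\theta^{-1}(g)$ has exactly two elements and $\theta$ is a bijection from $E^{F'}\setminus\theta^{-1}(g)$ onto $E^F\setminus\{g\}$. Extend $\theta$ to sequences of edges of $F'\uplus G$ by the identity on $E^G$.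 **Circuit-quantifying maps.** A map $q$ from cycles, modulo renaming of edges, to $\mathbb R_{\ge0}\cup\{\infty\}$ is $\mathfrak m$-circuit-quantifying if 1. $q(\pi_1)=q(\pi_2)$ whenever $\pi_1,\pi_2$ are cycles that are cyclic permutations of each other; 2. (refinement-invariance) for all graphings $F,G$, every simple refinement $(F',\theta)$ of $F$ and every choice $R_{F,G}$ of representatives of circuits, there is a choice $R_{F',G}$ such that for every alternating $1$-cycle $\pi$ between $F$ and $G$ $$\sum_{\rho\in\{\pi^k\mid k\in\mathbb N\}\cap R_{F,G}}q(\rho)=\sum_{\rho\in R_{F',G},\ \theta(\rho)\in\{\pi^k\mid k\in\mathbb N\}\cap R_{F,G}}q(\rho).$$ **The map $\bar q_m$.** For a cycle $\pi=e_0\dots e_n$ let $\omega(\pi)=\omega_{e_0}\cdots\omega_{e_n}$, let $\phi_\pi$ be the partial map $\phi_{e_n}\circ\dots\circ\phi_{e_0}$ with its natural domain, let $\{\phi_\pi\}=\bigcap_{k\in\mathbb N}\phi_\pi^k(X)\cap\phi_\pi^{-k}(X)$, and for $x\in\{\phi_\pi\}$ let $\rho_{\phi_\pi}(x)\in\{1,2,\dots\}\cup\{\infty\}$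 be the least $k\ge1$ with $\phi_\pi^k(x)=x$ ($\infty$ if there is none). The support $\mathrm{supp}(\pi)$ is the set of $x\in\{\phi_\pi\}$ with $\rho_{\phi_\pi}(x)<\infty$. Let $m:\Omega\to\mathbb R_{\ge0}\cup\{\infty\}$. If $\pi$ is not a $1$-cycle, put $\bar q_m(\pi)=0$; if it is, put $$\bar q_m(\pi)=\sum_{j=0}^{n}\int_{\mathrm{supp}(\pi)}\ \sum_{k=0}^{\rho_{\phi_\pi}(x)-1}\frac{m\bigl(\omega(\pi)^{\rho_{\phi_\pi}(\phi_\pi^k(x))}\bigr)}{(n+1)\,\rho_{\phi_\pi}(x)\,\rho_{\phi_\pi}(\phi_\pi^k(x))}\ d\,(\phi_{e_n}\circ\dots\circ\phi_{e_j})_*\lambda(x),$$ where $\phi_{e_n}\circ\dots\circ\phi_{e_j}$ is regarded as a map from $\mathrm{supp}(e_j\dots e_ne_0\dots e_{j-1})$ to $\mathrm{supp}(\pi)$, that is, the measure is the push-forward of the restriction of $\lambda$ to $\mathrm{supp}(e_j\dots e_ne_0\dots e_{j-1})$. **Theorem.** If $m$ is tracial, i.e. $m(ab)=m(ba)$ for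 all $a,b\in\Omega$, then $\bar q_m$ is an $\mathfrak m$-circuit-quantifying map. -/

import Mathlib

open MeasureTheory
open scoped ENNReal

namespace IGraphings

/-- Measurable maps `X → X` that send measurable sets to measurable sets and such that, for
measurable `A`, the image of `A` is null if and only if `A` is null. -/
structure IsNonSingularMeasurablePreserving {X : Type*} [MeasurableSpace X] (μ : Measure X)
    (f : X → X) : Prop where
  measurable : Measurable f
  measurableSet_image : ∀ A : Set X, MeasurableSet A → MeasurableSet (f '' A)
  null_iff : ∀ A : Set X, MeasurableSet A → (μ (f '' A) = 0 ↔ μ A = 0)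

/-- A microcosm: a set of non-singular measurable-preserving maps containing the identity and
closed under composition. -/
structure Microcosm {X : Type*} [MeasurableSpace X] (μ : Measure X) where
  maps : Set (X → X)
  nonSingular : ∀ f ∈ maps, IsNonSingularMeasurablePreserving μ f
  id_mem : id ∈ maps
  comp_mem : ∀ f ∈ maps, ∀ g ∈ maps, f ∘ g ∈ maps

/-- The macrocosm: the microcosm of all non-singular measurable-preserving maps. -/
def macrocosm {X : Type*} [MeasurableSpace X] (μ : Measure X) : Microcosm μ where
  maps := {f | IsNonSingularMeasurablePreserving μ f}
  nonSingular := fun _ hf => hf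
  id_mem := ⟨measurable_id, fun A hA => by simpa using hA, fun A _ => by simp⟩
  comp_mem := by
    intro f hf g hg
    refine ⟨hf.measurable.comp hg.measurable, fun A hA => ?_, fun A hA => ?_⟩
    · rw [Set.image_comp]
      exact hf.measurableSet_image _ (hg.measurableSet_image _ hA)
    · rw [Set.image_comp, hf.null_iff _ (hg.measurableSet_image _ hA), hg.null_iff _ hA]

/-- An `Ω`-weighted graphing in the microcosm `𝔪`: a countable family of edges, each with a weight,
a measurable source `S_e` inside the carrier, and a realiser, which is the restriction to `S_e` of
the element `map e` of the microcosm (the values of `map e` outside `S_e` are irrelevant); the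
target, which is the image of the source, lies in the carrier too. -/
structure Graphing (Ω : Type*) {X : Type*} [MeasurableSpace X] {μ : Measure X}
    (𝔪 : Microcosm μ) where
  carrier : Set X
  measurableSet_carrier : MeasurableSet carrier
  Edge : Type
  countable_edge : Countable Edge
  weight : Edge → Ω
  source : Edge → Set X
  measurableSet_source : ∀ e, MeasurableSet (source e)
  source_subset : ∀ e, source e ⊆ carrier
  map : Edge → X → X
  map_mem : ∀ e, map e ∈ 𝔪.maps
  image_subset : ∀ e, map e '' source e ⊆ carrier

variable {Ω : Type*} {X : Type*} [MeasurableSpace X] {μ : Measure X} {𝔪 : Microcosm μ}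

/-- The target `T_e = φ_e(S_e)` of an edge. -/
def Graphing.target (H : Graphing Ω 𝔪) (e : H.Edge) : Set X := H.map e '' H.source e

/-- The plugging of `F` and `G`: the disjoint union of the two families. The colour of an edge is
the side of the sum it belongs to. -/
def Graphing.plug (F G : Graphing Ω 𝔪) : Graphing Ω 𝔪 where
  carrier := F.carrier ∪ G.carrier
  measurableSet_carrier := F.measurableSet_carrier.union G.measurableSet_carrier
  Edge := F.Edge ⊕ G.Edge
  countable_edge := by
    have := F.countable_edge
    have := G.countable_edge
    infer_instance
  weight := Sum.elim F.weight G.weight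
  source := Sum.elim F.source G.source
  measurableSet_source := by
    rintro (e | e)
    · exact F.measurableSet_source e
    · exact G.measurableSet_source e
  source_subset := by
    rintro (e | e)
    · exact (F.source_subset e).trans Set.subset_union_left
    · exact (G.source_subset e).trans Set.subset_union_right
  map := Sum.elim F.map G.map
  map_mem := by
    rintro (e | e)
    · exact F.map_mem e
    · exact G.map_mem e
  image_subset := by
    rintro (e | e)
    · exact (F.image_subset e).trans Set.subset_union_left
    · exact (G.image_subset e).trans Set.subset_union_right

/-! ### Paths, cycles, circuits -/

/-- A path `e₀ … eₙ`: a non-empty finite sequence of edges in which each target meets the next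
source in a set of positive measure. -/
def Graphing.IsPath (H : Graphing Ω 𝔪) (π : List H.Edge) : Prop :=
  π ≠ [] ∧ π.IsChain (fun e e' => 0 < μ (H.target e ∩ H.source e'))

/-- A cycle: a path whose first source meets its last target in a set of positive measure. -/
def Graphing.IsCycle (H : Graphing Ω 𝔪) (π : List H.Edge) : Prop :=
  H.IsPath π ∧ ∀ h : π ≠ [], 0 < μ (H.source (π.head h) ∩ H.target (π.getLast h))

/-- `pow π k` is the concatenation of `k` copies of `π`. -/
def pow {E : Type*} (π : List E) (k : ℕ) : List E := (List.replicate k π).flatten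

/-- A `1`-cycle: a cycle that is not a proper power of a cycle. -/
def Graphing.IsOneCycle (H : Graphing Ω 𝔪) (π : List H.Edge) : Prop :=
  H.IsCycle π ∧ ¬ ∃ (ρ : List H.Edge) (k : ℕ), H.IsCycle ρ ∧ 1 < k ∧ π = pow ρ k

/-- An alternating cycle between `F` and `G`: a cycle in their plugging in which consecutive edges
have different colours, and so have the last and the first edge. -/
def IsAltCycle (F G : Graphing Ω 𝔪) (π : List (F.Edge ⊕ G.Edge)) : Prop :=
  (F.plug G).IsCycle π ∧ π.IsChain (fun e e' => e.isLeft ≠ e'.isLeft) ∧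
    ∀ h : π ≠ [], (π.head h).isLeft ≠ (π.getLast h).isLeft

/-- A choice of representatives of circuits: a set of alternating cycles that contains exactly one
element of each class of alternating cycles modulo cyclic permutation (`~r` in Mathlib), and that
contains `π` as soon as it contains a power of `π`. -/
structure IsRepChoice (F G : Graphing Ω 𝔪) (R : Set (List (F.Edge ⊕ G.Edge))) : Prop where
  altCycle : ∀ π ∈ R, IsAltCycle F G π
  existsUnique : ∀ ρ, IsAltCycle F G ρ → ∃! π, π ∈ R ∧ List.IsRotated ρ π
  root_mem : ∀ (π : List (F.Edge ⊕ G.Edge)) (k : ℕ), pow π k ∈ R → π ∈ R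

/-! ### Refinements -/

/-- `(F', θ)` is a refinement of `F`. -/
structure IsRefinement (F' F : Graphing Ω 𝔪) (θ : F'.Edge → F.Edge) : Prop where
  disjoint_source : ∀ e e', θ e = θ e' → e ≠ e' → μ (F'.source e ∩ F'.source e') = 0
  disjoint_target : ∀ e e', θ e = θ e' → e ≠ e' → μ (F'.target e ∩ F'.target e') = 0
  weight_eq : ∀ e, F.weight (θ e) = F'.weight e
  source_eq : ∀ f, F.source f =ᵐ[μ] ⋃ e ∈ θ ⁻¹' {f}, F'.source e
  target_eq : ∀ f, F.target f =ᵐ[μ] ⋃ e ∈ θ ⁻¹' {f}, F'.target e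
  map_eq : ∀ e, ∀ᵐ x ∂μ, x ∈ F.source (θ e) ∩ F'.source e → F.map (θ e) x = F'.map e x

/-- `(F', θ)` is a simple refinement of `F`: for some edge `g`, exactly two edges lie above `g`, and
`θ` is a bijection from the other edges of `F'` onto the other edges of `F`. -/
def IsSimpleRefinement (F' F : Graphing Ω 𝔪) (θ : F'.Edge → F.Edge) : Prop :=
  IsRefinement F' F θ ∧
    ∃ g : F.Edge, (θ ⁻¹' {g}).ncard = 2 ∧ Set.BijOn θ (θ ⁻¹' {g})ᶜ {g}ᶜ

/-- The set `π^ω` of the powers of `π` that belong to `R`. -/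
def powersIn {E : Type*} (R : Set (List E)) (π : List E) : Set (List E) :=
  {ρ | ∃ k : ℕ, ρ = pow π k} ∩ R

/-- The set of the chosen representatives of circuits between `F'` and `G` whose image under `θ`
(which leaves the edges of `G` unchanged) belongs to `π^ω`. -/
def cyclesAbove {F' F : Graphing Ω 𝔪} (G : Graphing Ω 𝔪) (θ : F'.Edge → F.Edge)
    (R : Set (List (F.Edge ⊕ G.Edge))) (R' : Set (List (F'.Edge ⊕ G.Edge)))
    (π : List (F.Edge ⊕ G.Edge)) : Set (List (F'.Edge ⊕ G.Edge)) :=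
  {ρ | ρ ∈ R' ∧ ρ.map (Sum.map θ id) ∈ powersIn R π}

/-! ### Circuit-quantifying maps -/

/-- Refinement-invariance of a map on cycles with values in `[0, ∞]`. -/
def IsRefinementInvariant (𝔪 : Microcosm μ)
    (q : (H : Graphing Ω 𝔪) → List H.Edge → ℝ≥0∞) : Prop :=
  ∀ (F G F' : Graphing Ω 𝔪) (θ : F'.Edge → F.Edge), IsSimpleRefinement F' F θ →
    ∀ R : Set (List (F.Edge ⊕ G.Edge)), IsRepChoice F G R →
      ∃ R' : Set (List (F'.Edge ⊕ G.Edge)), IsRepChoice F' G R' ∧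
        ∀ π : List (F.Edge ⊕ G.Edge), IsAltCycle F G π → (F.plug G).IsOneCycle π →
          ∑' ρ : powersIn R π, q (F.plug G) ρ.1 =
            ∑' ρ : cyclesAbove G θ R R' π, q (F'.plug G) ρ.1

/-- An `𝔪`-circuit-quantifying map. A map on cycles is given by its values on the edge sequences of
each graphing in `𝔪`; only the values on cycles matter. The field `rename_eq` says that it is indeed
a map on cycles modulo renaming of edges: the value depends neither on the names of the edges nor on
the edges that the cycle does not use. -/
structure IsCircuitQuantifying (𝔪 : Microcosm μ)
    (q : (H : Graphing Ω 𝔪) → List H.Edge → ℝ≥0∞) : Prop where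
  rename_eq : ∀ (H H' : Graphing Ω 𝔪) (σ : H.Edge → H'.Edge) (π : List H.Edge), H.IsCycle π →
    Set.InjOn σ {e | e ∈ π} →
    (∀ e ∈ π, H'.weight (σ e) = H.weight e ∧ H'.source (σ e) = H.source e ∧
      Set.EqOn (H'.map (σ e)) (H.map e) (H.source e)) →
    q H' (π.map σ) = q H π
  rotation_eq : ∀ (H : Graphing Ω 𝔪) (π₁ π₂ : List H.Edge), H.IsCycle π₁ → H.IsCycle π₂ →
    List.IsRotated π₁ π₂ → q H π₁ = q H π₂
  refinement_invariant : IsRefinementInvariant 𝔪 q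

/-! ### The map `q̄_m` -/

/-- The weight `ω(π)` of a path, the product of the weights of its edges in order. -/
def Graphing.pathWeight [Monoid Ω] (H : Graphing Ω 𝔪) (π : List H.Edge) : Ω :=
  (π.map H.weight).prod

/-- The composite `φ_{eₙ} ∘ ⋯ ∘ φ_{e₀}` of the maps along a path `e₀ … eₙ`. The realiser `φ_π` of
the path is the restriction of it to `pathDom π`. -/
def Graphing.pathMap (H : Graphing Ω 𝔪) : List H.Edge → X → X
  | [] => id
  | e :: π => H.pathMap π ∘ H.map e

/-- The domain `S_π` of the realiser of a path. -/
def Graphing.pathDom (H : Graphing Ω 𝔪) : List H.Edge → Set X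
  | [] => Set.univ
  | e :: π => H.source e ∩ H.map e ⁻¹' H.pathDom π

/-- The domain `φ⁻ⁿ(X)` of the `n`-th iterate of the partial map `φ`, the restriction of `f` to
`D`. -/
def iterDom (f : X → X) (D : Set X) (n : ℕ) : Set X := {x | ∀ i < n, f^[i] x ∈ D}

/-- The set `{φ} = ⋂ₙ φⁿ(X) ∩ φ⁻ⁿ(X)` for the partial map `φ`, the restriction of `f` to `D`. -/
def stableSet (f : X → X) (D : Set X) : Set X :=
  ⋂ n : ℕ, f^[n] '' iterDom f D n ∩ iterDom f D n

/-- The support of a cycle `π`: the points of `{φ_π}` at which the period `ρ` of `φ_π` is finite.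
On it the period is `Function.minimalPeriod (H.pathMap π)`, the least `n ≥ 1` with `φ_πⁿ(x) = x`. -/
def Graphing.supp (H : Graphing Ω 𝔪) (π : List H.Edge) : Set X :=
  {x | x ∈ stableSet (H.pathMap π) (H.pathDom π) ∧ ∃ n : ℕ, 1 ≤ n ∧ (H.pathMap π)^[n] x = x}

/-- The map `q̄_m`. For a `1`-cycle `π = e₀ … eₙ` it is the sum over `0 ≤ j ≤ n` of the integrals
over the support of `π` of the average along the orbit of `m(ω(π)^ρ) / ρ`, divided by `n + 1`,
against the push-forward of `μ` under `φ_{eₙ} ∘ ⋯ ∘ φ_{eⱼ}`, seen as a map from the support of the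
rotated cycle `eⱼ … eₙ e₀ … eⱼ₋₁` to the support of `π`. It vanishes on cycles that are not
`1`-cycles. -/
noncomputable def qbar [Monoid Ω] (𝔪 : Microcosm μ) (m : Ω → ℝ≥0∞) (H : Graphing Ω 𝔪)
    (π : List H.Edge) : ℝ≥0∞ :=
  open Classical in
  if H.IsOneCycle π then
    ∑ j ∈ Finset.range π.length,
      ∫⁻ x in H.supp π,
        ∑ k ∈ Finset.range (Function.minimalPeriod (H.pathMap π) x),
          m (H.pathWeight π ^ Function.minimalPeriod (H.pathMap π) ((H.pathMap π)^[k] x)) /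
            ((π.length : ℝ≥0∞) * (Function.minimalPeriod (H.pathMap π) x : ℝ≥0∞) *
              (Function.minimalPeriod (H.pathMap π) ((H.pathMap π)^[k] x) : ℝ≥0∞))
        ∂(Measure.map (H.pathMap (π.drop j)) (μ.restrict (H.supp (π.rotate j))))
  else 0

/-- Traciality. -/
def IsTracial [Monoid Ω] (m : Ω → ℝ≥0∞) : Prop := ∀ a b : Ω, m (a * b) = m (b * a)

end IGraphings

/-! For a word `w` let `I(w)` be the integral over `supp w` of `m(ω(w)^p) / (|w| p)`, where `p` is
the period (`suppIntegral`). On the support the period is constant along orbits, so the orbit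
average in `q̄_m` collapses. The map `φ_{eₙ} ∘ ⋯ ∘ φ_{eⱼ}` carries the support of the `j`-th
rotation of `π` into that of `π` and preserves periods, and traciality exchanges the weight of `π`
with that of its rotation. A change of variables thus turns `q̄_m(π)` into the sum of `I` over the
rotations of `π` (`qbar_eq`), from which rotation-invariance is immediate.

Refinement-invariance rests on `IsRefinement.suppIntegral_eq_tsum`: `I(π)` is the sum of `I(w)` over
the primitive words `w` of the refinement whose infinite repetition lies above that of `π`. The
realisers are non-singular, so for almost every `x` the whole trajectory along `πππ…` avoids the
null sets allowed in a refinement. If such an `x` lies in `supp π`, its trajectory follows exactly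
one sequence of refined edges. As `x` returns to itself, uniqueness makes that sequence periodic,
hence the repetition of one primitive word `w`. The edge-length of the full orbit is the same in
both graphings, `|w| p' = |π| p`, and so is the weight read along it; the integrands therefore agree
at `x`. Words above `π` that are not cycles have null support.

What remains is combinatorial (`IsReps.tsum_lift_rotSum`): words above the rotations of `π` are
counted once as rotations of representatives. This requires representatives upstairs whose images
are representatives downstairs (`IsReps.exists_lift`).

The topology of `X` enters through measurability of the diagonal, which makes periods measurable. -/

namespace IGraphings

/-! ### Periodic sequences and primitive words -/

section Words

variable {E E' : Type*}

/-- The shift of a sequence. -/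
def shift (s : ℕ → E) : ℕ → E := fun i => s (i + 1)

theorem shift_iterate (s : ℕ → E) (n i : ℕ) : shift^[n] s i = s (i + n) := by
  induction n generalizing i with
  | zero => rfl
  | succ n ih =>
    rw [Function.iterate_succ_apply', shift, ih]
    congr 1
    omega

theorem isPeriodicPt_shift_iff {s : ℕ → E} {n : ℕ} :
    Function.IsPeriodicPt shift n s ↔ ∀ i, s (i + n) = s i := by
  simp only [Function.IsPeriodicPt, Function.IsFixedPt, funext_iff, shift_iterate]

/-- The periodic sequence obtained by repeating a non-empty word. -/
def cyc (w : List E) (h : w ≠ []) (i : ℕ) : E :=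
  w[i % w.length]'(Nat.mod_lt _ (List.length_pos_iff.2 h))

theorem cyc_of_lt {w : List E} (h : w ≠ []) {i : ℕ} (hi : i < w.length) : cyc w h i = w[i] := by
  simp only [cyc, Nat.mod_eq_of_lt hi]

theorem cyc_mod {w : List E} (h : w ≠ []) (i : ℕ) : cyc w h (i % w.length) = cyc w h i := by
  simp only [cyc, Nat.mod_mod]

theorem cyc_congr {u v : List E} (hu : u ≠ []) (hv : v ≠ []) (h : u = v) : cyc u hu = cyc v hv := by
  subst h
  rfl

theorem cyc_map (f : E → E') {w : List E} (h : w ≠ []) (h' : w.map f ≠ []) :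
    cyc (w.map f) h' = f ∘ cyc w h := by
  funext i
  simp [cyc]

theorem cyc_rotate {w : List E} (h : w ≠ []) (j : ℕ) (h' : w.rotate j ≠ []) :
    cyc (w.rotate j) h' = shift^[j] (cyc w h) := by
  funext i
  simp [cyc, shift_iterate, List.getElem_rotate]

theorem isPeriodicPt_cyc {w : List E} (h : w ≠ []) :
    Function.IsPeriodicPt shift w.length (cyc w h) :=
  isPeriodicPt_shift_iff.2 fun i => by simp [cyc]

theorem cyc_mem_periodicPts {w : List E} (h : w ≠ []) :
    cyc w h ∈ Function.periodicPts shift :=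
  ⟨w.length, List.length_pos_iff.2 h, isPeriodicPt_cyc h⟩

theorem eq_of_cyc_eq {u v : List E} (hu : u ≠ []) (hv : v ≠ []) (hl : u.length = v.length)
    (h : cyc u hu = cyc v hv) : u = v :=
  List.ext_getElem hl fun i hi hi' => by rw [← cyc_of_lt hu hi, ← cyc_of_lt hv hi', h]

theorem length_pow (w : List E) (k : ℕ) : (pow w k).length = k * w.length := by
  simp [pow]

theorem pow_succ_eq (w : List E) (k : ℕ) : pow w (k + 1) = w ++ pow w k := by
  simp [pow, List.replicate_succ]

theorem pow_one_eq (w : List E) : pow w 1 = w := by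
  simp [pow]

theorem pow_zero_eq (w : List E) : pow w 0 = [] := by
  simp [pow]

theorem getElem_pow {w : List E} (h : w ≠ []) (k i : ℕ) (hi : i < (pow w k).length) :
    (pow w k)[i] = cyc w h i := by
  induction k generalizing i with
  | zero => simp [pow] at hi
  | succ k ih =>
    simp only [pow_succ_eq, List.getElem_append]
    split_ifs with hlt
    · rw [cyc_of_lt h hlt]
    · rw [ih]
      simp only [cyc]
      congr 1
      exact (Nat.mod_eq_sub_mod (by omega)).symm

theorem pow_ne_nil {w : List E} (h : w ≠ []) {k : ℕ} (hk : 0 < k) : pow w k ≠ [] := by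
  rw [← List.length_pos_iff, length_pow]
  exact Nat.mul_pos hk (List.length_pos_iff.2 h)

theorem ne_nil_of_pow_ne_nil {w : List E} {k : ℕ} (h : pow w k ≠ []) : w ≠ [] ∧ 0 < k := by
  rw [← List.length_pos_iff, length_pow] at h
  exact ⟨List.length_pos_iff.1 (Nat.pos_of_mul_pos_left h), Nat.pos_of_mul_pos_right h⟩

theorem cyc_pow {w : List E} (h : w ≠ []) {k : ℕ} (h' : pow w k ≠ []) :
    cyc (pow w k) h' = cyc w h := by
  funext i
  rw [cyc, getElem_pow h, length_pow, cyc, cyc]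
  congr 1
  exact Nat.mod_mod_of_dvd _ (dvd_mul_left _ _)

/-- A primitive word: a word that is not a proper power. -/
def IsPrim (w : List E) : Prop :=
  ∃ h : w ≠ [], Function.minimalPeriod shift (cyc w h) = w.length

theorem IsPrim.rotate {w : List E} (hw : IsPrim w) (j : ℕ) : IsPrim (w.rotate j) := by
  refine ⟨by simpa using hw.1, ?_⟩
  rw [cyc_rotate hw.1, Function.minimalPeriod_apply_iterate (cyc_mem_periodicPts _),
    List.length_rotate, hw.2]

theorem IsPrim.rotate_injOn {w : List E} (hw : IsPrim w) {i j : ℕ} (hi : i < w.length)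
    (hj : j < w.length) (h : w.rotate i = w.rotate j) : i = j := by
  have hi' : w.rotate i ≠ [] := by simpa using hw.1
  have hj' : w.rotate j ≠ [] := by simpa using hw.1
  have : shift^[i] (cyc w hw.1) = shift^[j] (cyc w hw.1) := by
    rw [← cyc_rotate hw.1 i hi', ← cyc_rotate hw.1 j hj']
    exact cyc_congr _ _ h
  exact (Function.iterate_eq_iterate_iff_of_lt_minimalPeriod (hw.2 ▸ hi) (hw.2 ▸ hj)).1 this

theorem IsPrim.eq_of_cyc_eq {u v : List E} (hu : IsPrim u) (hv : IsPrim v)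
    (h : cyc u hu.1 = cyc v hv.1) : u = v :=
  IGraphings.eq_of_cyc_eq hu.1 hv.1 (by rw [← hu.2, ← hv.2, h]) h

/-- A periodic sequence is the repetition of a primitive word. -/
theorem exists_isPrim_cyc_eq {s : ℕ → E} (hs : s ∈ Function.periodicPts shift) :
    ∃ (v : List E) (hv : IsPrim v), cyc v hv.1 = s := by
  have hp := Function.minimalPeriod_pos_of_mem_periodicPts hs
  set p := Function.minimalPeriod shift s with hpdef
  let v : List E := List.ofFn fun i : Fin p => s i
  have hv : v ≠ [] := by
    rw [← List.length_pos_iff]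
    simpa [v] using hp
  have hc : cyc v hv = s := by
    funext i
    have hper := Function.iterate_mod_minimalPeriod_eq (f := shift) (x := s) (n := i)
    have := congrFun hper 0
    simp only [shift_iterate, zero_add] at this
    simp only [cyc, v, List.getElem_ofFn, List.length_ofFn]
    exact this
  refine ⟨v, ⟨hv, ?_⟩, hc⟩
  rw [hc]
  simp [v, hpdef]

theorem IsPrim.exists_eq_pow {v w : List E} (hv : IsPrim v) (hw : w ≠ [])
    (h : cyc w hw = cyc v hv.1) : ∃ k, 0 < k ∧ w = pow v k := by
  obtain ⟨k, hk⟩ : v.length ∣ w.length := by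
    rw [← hv.2, ← h]
    exact (isPeriodicPt_cyc hw).minimalPeriod_dvd
  have hk0 : 0 < k := by
    rcases Nat.eq_zero_or_pos k with rfl | h0
    · exact absurd (List.length_eq_zero_iff.1 (by simpa using hk)) hw
    · exact h0
  refine ⟨k, hk0, IGraphings.eq_of_cyc_eq hw (pow_ne_nil hv.1 hk0) ?_ ?_⟩
  · rw [length_pow, hk, mul_comm]
  · rw [h, cyc_pow hv.1]

theorem exists_root {w : List E} (hw : w ≠ []) :
    ∃ (v : List E) (_ : IsPrim v) (k : ℕ), 0 < k ∧ w = pow v k := by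
  obtain ⟨v, hv, h⟩ := exists_isPrim_cyc_eq (cyc_mem_periodicPts hw)
  obtain ⟨k, hk, rfl⟩ := hv.exists_eq_pow hw h.symm
  exact ⟨v, hv, k, hk, rfl⟩

/-- If `w = ρ^k`, then `|ρ|` is already a period of the repetition of `w`; conversely, one minimal
period of that repetition is a root of `w`. -/
theorem isPrim_iff {w : List E} (hw : w ≠ []) :
    IsPrim w ↔ ¬ ∃ (ρ : List E) (k : ℕ), 1 < k ∧ w = pow ρ k := by
  constructor
  · rintro h ⟨ρ, k, hk, rfl⟩
    have hρ := (ne_nil_of_pow_ne_nil hw).1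
    have h1 := h.2
    rw [cyc_pow hρ, length_pow] at h1
    have h2 := (isPeriodicPt_cyc hρ).minimalPeriod_le (List.length_pos_iff.2 hρ)
    rw [h1] at h2
    have h3 := List.length_pos_iff.2 hρ
    nlinarith
  · intro h
    obtain ⟨v, hv, k, hk, rfl⟩ := exists_root hw
    rcases Nat.lt_or_ge 1 k with h1 | h1
    · exact absurd ⟨v, k, h1, rfl⟩ h
    · obtain rfl : k = 1 := by omega
      rwa [pow_one_eq]

theorem pow_rotate (w : List E) (k j : ℕ) : (pow w k).rotate j = pow (w.rotate j) k := by
  rcases Nat.eq_zero_or_pos k with rfl | hk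
  · simp [pow_zero_eq]
  rcases eq_or_ne w [] with rfl | hw
  · simp [pow]
  have hr : w.rotate j ≠ [] := by simpa using hw
  have h1 : pow w k ≠ [] := pow_ne_nil hw hk
  have h2 : (pow w k).rotate j ≠ [] := by simpa using h1
  refine eq_of_cyc_eq h2 (pow_ne_nil hr hk) (by simp [length_pow]) ?_
  rw [cyc_rotate h1, cyc_pow hw, cyc_pow hr, cyc_rotate hw]

/-- `w` is cyclically chained by `r`: consecutive letters are related by `r`, and so are the last
and the first one. -/
def CycChain (r : E → E → Prop) (w : List E) : Prop :=
  ∃ h : w ≠ [], ∀ i, r (cyc w h i) (cyc w h (i + 1))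

/-- Links the list form in which cycles are defined to a condition on the infinite repetition. In
the second form, invariance under rotation and under taking powers or roots is immediate. -/
theorem cycChain_iff {r : E → E → Prop} {w : List E} :
    CycChain r w ↔ w ≠ [] ∧ w.IsChain r ∧ ∀ h : w ≠ [], r (w.getLast h) (w.head h) := by
  rw [CycChain, exists_prop_congr (q' := fun h : w ≠ [] => w.IsChain r ∧ r (w.getLast h) (w.head h))
    ?_ Iff.rfl]
  · constructor
    · rintro ⟨h, h1, h2⟩
      exact ⟨h, h1, fun _ => h2⟩
    · rintro ⟨h, h1, h2⟩
      exact ⟨h, h1, h2 h⟩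
  intro h
  have hl := List.length_pos_iff.2 h
  rw [List.isChain_iff_getElem]
  have hlast : w.getLast h = cyc w h (w.length - 1) := by
    rw [cyc_of_lt h (by omega), List.getLast_eq_getElem]
  have hhead : w.head h = cyc w h (w.length - 1 + 1) := by
    rw [← cyc_mod, Nat.sub_add_cancel hl, Nat.mod_self, cyc_of_lt h hl, List.head_eq_getElem]
  constructor
  · intro H
    refine ⟨fun i hi => ?_, ?_⟩
    · rw [← cyc_of_lt h hi, ← cyc_of_lt h (by omega)]
      exact H i
    · rw [hlast, hhead]
      exact H _
  · rintro ⟨H1, H2⟩ i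
    have hi := Nat.mod_lt i hl
    rw [← cyc_mod h i, ← cyc_mod h (i + 1), Nat.add_mod]
    rcases Nat.lt_or_ge (i % w.length + 1) w.length with hlt | hge
    · have h1 : (i % w.length + 1 % w.length) % w.length = i % w.length + 1 := by
        rw [Nat.add_mod_mod, Nat.mod_eq_of_lt hlt]
      rw [h1, cyc_of_lt h hi, cyc_of_lt h hlt]
      exact H1 _ hlt
    · have h1 : i % w.length = w.length - 1 := by omega
      rw [h1, Nat.add_mod_mod]
      rw [hlast, hhead, ← cyc_mod h (w.length - 1 + 1)] at H2
      exact H2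

theorem CycChain.rotate {r : E → E → Prop} {w : List E} (h : CycChain r w) (j : ℕ) :
    CycChain r (w.rotate j) := by
  refine ⟨by simpa using h.1, fun i => ?_⟩
  rw [cyc_rotate h.1, shift_iterate, shift_iterate, add_right_comm]
  exact h.2 _

theorem cycChain_pow_iff {r : E → E → Prop} {w : List E} {k : ℕ} (hk : 0 < k) :
    CycChain r (pow w k) ↔ CycChain r w := by
  constructor
  · rintro ⟨h, H⟩
    have hw := (ne_nil_of_pow_ne_nil h).1
    rw [cyc_pow hw] at H
    exact ⟨hw, H⟩
  · rintro ⟨h, H⟩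
    refine ⟨pow_ne_nil h hk, ?_⟩
    rwa [cyc_pow h]

theorem CycChain.map {r' : E' → E' → Prop} {r : E → E → Prop} {f : E' → E}
    (hf : ∀ a b, r' a b → r (f a) (f b)) {w : List E'} (h : CycChain r' w) :
    CycChain r (w.map f) := by
  refine ⟨by simpa using h.1, fun i => ?_⟩
  rw [cyc_map f h.1]
  exact hf _ _ (h.2 i)

end Words

/-! ### Representatives of circuits and their lifts -/

section Representatives

variable {E E' : Type*}

/-- A choice of representatives, stable under roots, of the words cyclically chained by `r` modulo
cyclic permutation. -/
structure IsReps (r : E → E → Prop) (R : Set (List E)) : Prop where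
  cycChain : ∀ π ∈ R, CycChain r π
  existsUnique : ∀ ρ, CycChain r ρ → ∃! π, π ∈ R ∧ List.IsRotated ρ π
  root_mem : ∀ (π : List E) (k : ℕ), pow π k ∈ R → π ∈ R

variable {r : E → E → Prop} {r' : E' → E' → Prop} {R : Set (List E)} {R' : Set (List E')}

theorem IsReps.eq_of_isRotated (hR : IsReps r R) {u v : List E} (hu : u ∈ R) (hv : v ∈ R)
    (h : List.IsRotated u v) : u = v :=
  (hR.existsUnique u (hR.cycChain u hu)).unique ⟨hu, List.IsRotated.refl u⟩ ⟨hv, h⟩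

theorem isRotated_of_cyc_eq {u v : List E} (hu : IsPrim u) (hv : IsPrim v) {i j : ℕ}
    (h : shift^[i] (cyc u hu.1) = shift^[j] (cyc v hv.1)) : List.IsRotated u v := by
  have h1 : (u.rotate i) = v.rotate j := by
    refine (hu.rotate i).eq_of_cyc_eq (hv.rotate j) ?_
    rw [cyc_rotate hu.1, cyc_rotate hv.1, h]
  exact (List.IsRotated.trans ⟨i, h1⟩ (List.IsRotated.symm ⟨j, rfl⟩))

/-- Representatives can be lifted along a map of alphabets. -/
theorem IsReps.exists_lift (hR : IsReps r R) (f : E' → E)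
    (hf : ∀ a b, r' a b → r (f a) (f b)) :
    ∃ R' : Set (List E'), IsReps r' R' ∧ ∀ ρ ∈ R', IsPrim ρ → ρ.map f ∈ R := by
  -- In each class, a word whose image already lies in `R` is preferred whenever there is one.
  have hpick : ∀ c : Cycle E', ∃ v : List E', (v : Cycle E') = c ∧
      ((∃ u : List E', (u : Cycle E') = c ∧ u.map f ∈ R) → v.map f ∈ R) := by
    intro c
    by_cases h : ∃ u : List E', (u : Cycle E') = c ∧ u.map f ∈ R
    · obtain ⟨u, hu, hu'⟩ := h
      exact ⟨u, hu, fun _ => hu'⟩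
    · induction c using Quotient.inductionOn with
      | h u => exact ⟨u, rfl, fun h' => absurd h' h⟩
  choose pick pick_eq pick_mem using hpick
  have hrot : ∀ v : List E', List.IsRotated v (pick v) := fun v =>
    (Cycle.coe_eq_coe.1 (pick_eq v)).symm
  have hpickrot : ∀ u v : List E', List.IsRotated u v → pick (u : Cycle E') = pick v := by
    intro u v h
    rw [Cycle.coe_eq_coe.2 h]
  -- Choosing primitive words only and adding all their powers makes the set stable under roots.
  refine ⟨{w | CycChain r' w ∧ ∃ (v : List E') (k : ℕ), IsPrim v ∧ 0 < k ∧ w = pow v k ∧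
    v = pick (v : Cycle E')}, ⟨fun π hπ => hπ.1, ?_, ?_⟩, ?_⟩
  · intro ρ hρ
    obtain ⟨v, hv, k, hk, rfl⟩ := exists_root hρ.1
    obtain ⟨i, hi⟩ := hrot v
    have hself : v.rotate i = pick (v.rotate i : Cycle E') := by
      rw [hi]
      exact hpickrot _ _ (hrot v)
    refine ⟨pow (v.rotate i) k, ⟨⟨?_, v.rotate i, k, hv.rotate i, hk, rfl, hself⟩,
      i, pow_rotate v k i⟩, ?_⟩
    · rw [← pow_rotate]
      exact hρ.rotate i
    · rintro _ ⟨⟨hc, u, l, hu, hl, rfl, hupick⟩, j, hj⟩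
      have hne : pow v k ≠ [] := hρ.1
      have hne' : (pow v k).rotate j ≠ [] := by simpa using hne
      have hcyc : shift^[j] (cyc v hv.1) = shift^[0] (cyc u hu.1) := by
        have := cyc_congr hne' hc.1 hj
        rw [cyc_rotate hne, cyc_pow hv.1, cyc_pow hu.1] at this
        exact this
      have hvu : List.IsRotated v u := isRotated_of_cyc_eq hv hu hcyc
      have huv : u = v.rotate i := by rw [hupick, hi, hpickrot _ _ hvu]
      have hlen : k * v.length = l * u.length := by
        have := congrArg List.length hj
        simpa [length_pow] using this
      rw [huv, List.length_rotate] at hlen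
      rw [huv, Nat.eq_of_mul_eq_mul_right (List.length_pos_iff.2 hv.1) hlen]
  · rintro π k ⟨hc, v, l, hv, hl, heq, hvp⟩
    obtain ⟨hπ, hk⟩ := ne_nil_of_pow_ne_nil hc.1
    have hcyc : cyc π hπ = cyc v hv.1 := by
      have := cyc_congr hc.1 (pow_ne_nil hv.1 hl) heq
      rwa [cyc_pow hπ, cyc_pow hv.1] at this
    obtain ⟨j, hj, rfl⟩ := hv.exists_eq_pow hπ hcyc
    exact ⟨(cycChain_pow_iff hk).1 hc, v, j, hv, hj, rfl, hvp⟩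
  · rintro _ ⟨hc, v, l, hv, hl, rfl, hvp⟩ hprim
    have hl1 : l = 1 := by
      by_contra hne
      exact (isPrim_iff hc.1).1 hprim ⟨v, l, by omega, rfl⟩
    subst hl1
    rw [pow_one_eq] at hc ⊢
    rw [hvp]
    apply pick_mem
    -- The preferred case does occur: the representative of the image of `v` is a rotation of that
    -- image, hence the image of a rotation of `v`.
    obtain ⟨w, ⟨hw, i, hi⟩, -⟩ := hR.existsUnique _ (hc.map hf)
    refine ⟨v.rotate i, Cycle.coe_eq_coe.2 (List.IsRotated.symm ⟨i, rfl⟩), ?_⟩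
    rwa [List.map_rotate, hi]

/-- The root of `w` lies in `R` by stability under roots and is a rotation of `π`, so it is `π`
itself. -/
theorem IsReps.eq_of_pow (hR : IsReps r R) {π : List E} (hπ : IsPrim π) (hmem : π ∈ R)
    {w : List E} (hw : w ∈ R) (hw0 : w ≠ []) {t : ℕ}
    (h : cyc w hw0 = shift^[t] (cyc π hπ.1)) : ∃ k, w = pow π k := by
  obtain ⟨v, hv, k, hk, rfl⟩ := exists_root hw0
  have hv' := hR.root_mem v k hw
  rw [cyc_pow hv.1] at h
  have := hR.eq_of_isRotated hv' hmem (isRotated_of_cyc_eq (i := 0) hv hπ h)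
  exact ⟨k, this ▸ rfl⟩

/-- The value on a primitive word of the sum of `J` over its cyclic permutations; zero on the other
words. -/
noncomputable def rotSum (J : List E → ℝ≥0∞) (w : List E) : ℝ≥0∞ :=
  open Classical in if IsPrim w then ∑ j ∈ Finset.range w.length, J (w.rotate j) else 0

/-- Only the exponent `1` contributes: the empty word and the proper powers are not primitive. -/
theorem tsum_powersIn_rotSum (J : List E → ℝ≥0∞) {π : List E} (hπ : IsPrim π) (hmem : π ∈ R) :
    ∑' ρ : powersIn R π, rotSum J ρ.1 = ∑ j ∈ Finset.range π.length, J (π.rotate j) := by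
  have hself : π ∈ powersIn R π := ⟨⟨1, (pow_one_eq π).symm⟩, hmem⟩
  rw [tsum_eq_single ⟨π, hself⟩]
  · simp [rotSum, hπ]
  · rintro ⟨ρ, ⟨k, rfl⟩, hρ⟩ hne
    simp only [rotSum]
    rw [if_neg]
    intro hp
    refine (isPrim_iff hp.1).1 hp ⟨π, k, ?_, rfl⟩
    rcases Nat.lt_or_ge 1 k with h | h
    · exact h
    · have hk : k = 0 ∨ k = 1 := by omega
      rcases hk with rfl | rfl
      · exact absurd (pow_zero_eq π) hp.1
      · exact absurd (Subtype.ext (pow_one_eq π)) hne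

/-- Words above a primitive word `π`: the primitive words, cyclically chained by `r'`, whose
repetition is mapped to the repetition of `π`. -/
def primAbove (r' : E' → E' → Prop) (f : E' → E) (s : ℕ → E) : Set (List E') :=
  {w | ∃ h : IsPrim w, CycChain r' w ∧ f ∘ cyc w h.1 = s}

/-- Double counting. The pairs (primitive representative above `π`, rotation of it) and the pairs
(rotation of `π`, primitive chained word above it) both enumerate, without repetition, the primitive
chained words whose repeated image is a shift of that of `π`. -/
theorem IsReps.tsum_lift_rotSum (hR : IsReps r R) (hR' : IsReps r' R') {f : E' → E}
    (hRR' : ∀ ρ ∈ R', IsPrim ρ → ρ.map f ∈ R) (J : List E → ℝ≥0∞) (J' : List E' → ℝ≥0∞)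
    {π : List E} (hπ : IsPrim π) (hmem : π ∈ R)
    (hJ : ∀ j (hj : π.rotate j ≠ []),
      J (π.rotate j) = ∑' w : primAbove r' f (cyc (π.rotate j) hj), J' w.1) :
    ∑ j ∈ Finset.range π.length, J (π.rotate j) =
      ∑' ρ : {ρ : List E' | ρ ∈ R' ∧ ρ.map f ∈ powersIn R π}, rotSum J' ρ.1 := by
  let B : Set (List E') := {ρ | ρ ∈ R' ∧ ρ.map f ∈ powersIn R π}
  let A : Set (List E') := {ρ | ρ ∈ B ∧ IsPrim ρ}
  have hne : ∀ j, π.rotate j ≠ [] := fun j => by simpa using hπ.1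
  let g₁ : (Σ ρ : A, Fin ρ.1.length) → List E' := fun p => p.1.1.rotate p.2
  let g₂ : (Σ j : Fin π.length, primAbove r' f (cyc (π.rotate j) (hne j))) → List E' :=
    fun p => p.2.1
  have hrhs : ∑' ρ : B, rotSum J' ρ.1 =
      ∑' p : (Σ ρ : A, Fin ρ.1.length), J' (g₁ p) := by
    rw [ENNReal.tsum_sigma (fun (ρ : A) (j : Fin ρ.1.length) => J' (ρ.1.rotate j))]
    rw [tsum_subtype B (rotSum J'),
      tsum_subtype A (fun ρ => ∑' j : Fin ρ.length, J' (ρ.rotate j))]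
    refine tsum_congr fun ρ => ?_
    by_cases h1 : ρ ∈ B
    · by_cases h2 : IsPrim ρ
      · rw [Set.indicator_of_mem h1, Set.indicator_of_mem (show ρ ∈ A from ⟨h1, h2⟩), rotSum,
          if_pos h2, tsum_fintype, Finset.sum_range]
      · rw [Set.indicator_of_notMem (show ρ ∉ A from fun h => h2 h.2), Set.indicator_of_mem h1,
          rotSum, if_neg h2]
    · rw [Set.indicator_of_notMem h1, Set.indicator_of_notMem (show ρ ∉ A from fun h => h1 h.1)]
  have hlhs : ∑ j ∈ Finset.range π.length, J (π.rotate j) = ∑' p, J' (g₂ p) := by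
    rw [ENNReal.tsum_sigma (fun (j : Fin π.length)
      (w : primAbove r' f (cyc (π.rotate j) (hne j))) => J' w.1), tsum_fintype, Finset.sum_range]
    exact Finset.sum_congr rfl fun j _ => hJ j (hne j)
  have hg₁ : Function.Injective g₁ := by
    rintro ⟨⟨ρ, hρ⟩, i⟩ ⟨⟨τ, hτ⟩, j⟩ h
    have h' : ρ.rotate i = τ.rotate j := h
    have : ρ = τ := hR'.eq_of_isRotated hρ.1.1 hτ.1.1
      (List.IsRotated.trans ⟨i, h'⟩ (List.IsRotated.symm ⟨j, rfl⟩))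
    subst this
    have : i = j := Fin.ext (hρ.2.rotate_injOn i.2 j.2 h')
    subst this
    rfl
  -- A word determines its repeated image, and distinct rotations of the primitive word `π` have
  -- distinct repetitions.
  have hg₂ : Function.Injective g₂ := by
    rintro ⟨i, w, hw⟩ ⟨j, v, hv⟩ h
    have h' : w = v := h
    subst h'
    have : i = j := by
      refine Fin.ext (hπ.rotate_injOn i.2 j.2 ((hπ.rotate i).eq_of_cyc_eq (hπ.rotate j) ?_))
      rw [← hw.2.2, ← hv.2.2]
    subst this
    rfl
  have hrange : Set.range g₁ = Set.range g₂ := by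
    ext w
    constructor
    · rintro ⟨⟨⟨ρ, ⟨hρ, ⟨k, hk⟩, hk'⟩, hp⟩, i⟩, rfl⟩
      have hne' : ρ.map f ≠ [] := by simpa using hp.1
      have h1 := cyc_congr hne' (hk ▸ hne') hk
      rw [cyc_pow hπ.1, cyc_map f hp.1] at h1
      -- The image of `ρ` is a power of `π`, so `i` may exceed `|π|` and is reduced modulo it.
      have hlt := Nat.mod_lt (i : ℕ) (List.length_pos_iff.2 hπ.1)
      refine ⟨⟨⟨(i : ℕ) % π.length, hlt⟩, ρ.rotate i, hp.rotate i,
        (hR'.cycChain ρ hρ).rotate i, ?_⟩, rfl⟩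
      rw [cyc_rotate hp.1]
      rw [cyc_congr (hne ((i : ℕ) % π.length)) (hne i) (List.rotate_mod π i), cyc_rotate hπ.1, ← h1]
      funext n
      simp [shift_iterate]
    · rintro ⟨⟨i, w, hw, hc, hcyc⟩, rfl⟩
      obtain ⟨ρ, ⟨hρ, j, rfl⟩, -⟩ := hR'.existsUnique w hc
      have hprim : IsPrim (w.rotate j) := hw.rotate j
      have hρR := hRR' _ hρ hprim
      have hne' : (w.rotate j).map f ≠ [] := by simpa using hprim.1
      -- Because the image of the lifted representative lies in `R`, it is a power of `π` and not
      -- merely of a rotation of `π`.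
      obtain ⟨k, hk⟩ := hR.eq_of_pow hπ hmem hρR hne' (t := j + i) (by
        rw [cyc_map f hprim.1, cyc_rotate hw.1, Function.iterate_add_apply, ← cyc_rotate hπ.1 i (hne i),
          ← hcyc]
        funext n
        simp [shift_iterate])
      have hA : w.rotate j ∈ A := ⟨⟨hρ, ⟨k, hk⟩, hρR⟩, hprim⟩
      obtain ⟨l, hl⟩ : List.IsRotated (w.rotate j) w := List.IsRotated.symm ⟨j, rfl⟩
      have hlt := Nat.mod_lt l (List.length_pos_iff.2 hprim.1)
      exact ⟨⟨⟨w.rotate j, hA⟩, ⟨l % (w.rotate j).length, hlt⟩⟩, by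
        simp only [g₁, g₂]
        rw [List.rotate_mod, hl]⟩
  change _ = ∑' ρ : B, rotSum J' ρ.1
  rw [hrhs, hlhs, ← tsum_range J' hg₁, ← tsum_range J' hg₂, hrange]

end Representatives

/-! ### Supports, periods and their measurability -/

/-- If `f^N x = x`, then `x` is the image of `f^((N-1)n) x` under `f^n`, so the range condition in
the stable set is automatic at periodic points. -/
theorem mem_stableSet_and_periodic_iff {X : Type*} {f : X → X} {D : Set X} {x : X} :
    (x ∈ stableSet f D ∧ ∃ n : ℕ, 1 ≤ n ∧ f^[n] x = x) ↔
      (∀ i, f^[i] x ∈ D) ∧ ∃ n : ℕ, 1 ≤ n ∧ f^[n] x = x := by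
  refine and_congr_left ?_
  rintro ⟨N, hN, hx⟩
  constructor
  · intro h i
    exact ((Set.mem_iInter.1 h (i + 1)).2) i (Nat.lt_succ_self i)
  · intro h
    refine Set.mem_iInter.2 fun n => ⟨⟨f^[(N - 1) * n] x, ?_, ?_⟩, fun i _ => h i⟩
    · intro i _
      rw [← Function.iterate_add_apply]
      exact h _
    · rw [← Function.iterate_add_apply]
      have : n + (N - 1) * n = N * n := by
        obtain ⟨k, rfl⟩ := Nat.exists_eq_add_of_le hN
        simp
        ring
      rw [this]
      exact Function.IsPeriodicPt.mul_const (show Function.IsPeriodicPt f N x from hx) n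

theorem measurable_minimalPeriod {X : Type*} [MeasurableSpace X] [MeasurableEq X] {f : X → X}
    (hf : Measurable f) : Measurable (Function.minimalPeriod f) := by
  refine measurable_to_countable' fun n => ?_
  -- The value `n = 0` at non-periodic points needs no separate case, since `0 ∣ k` only for `k =
  -- 0`.
  have : Function.minimalPeriod f ⁻¹' {n} = ⋂ k, {x | f^[k] x = x ↔ n ∣ k} := by
    ext x
    simp only [Set.mem_preimage, Set.mem_singleton_iff, Set.mem_iInter, Set.mem_ofPred_eq]
    constructor
    · rintro rfl k
      exact Function.isPeriodicPt_iff_minimalPeriod_dvd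
    · intro h
      refine Nat.dvd_antisymm ?_ ?_
      · exact Function.IsPeriodicPt.minimalPeriod_dvd ((h n).2 dvd_rfl)
      · exact (h _).1 (Function.isPeriodicPt_minimalPeriod f x)
  rw [this]
  refine MeasurableSet.iInter fun k => ?_
  have h1 : MeasurableSet {x | f^[k] x = x} := measurableSet_eq_fun (hf.iterate k) measurable_id
  by_cases hk : n ∣ k
  · simpa [hk] using h1
  · convert h1.compl using 1
    ext x
    simp [hk]

variable {Ω : Type*} {X : Type*} [MeasurableSpace X] {μ : Measure X} {𝔪 : Microcosm μ}

/-- The hypothesis concerns images; applied to `f ⁻¹' s`, whose image lies in `s`, it shows that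
preimages of null sets are null. -/
theorem IsNonSingularMeasurablePreserving.quasiMeasurePreserving {f : X → X}
    (hf : IsNonSingularMeasurablePreserving μ f) : Measure.QuasiMeasurePreserving f μ μ := by
  refine ⟨hf.measurable, Measure.AbsolutelyContinuous.mk fun s hs h => ?_⟩
  rw [Measure.map_apply hf.measurable hs, ← hf.null_iff _ (hf.measurable hs)]
  exact measure_mono_null (Set.image_preimage_subset f s) h

namespace Graphing

variable (H : Graphing Ω 𝔪)

theorem quasiMeasurePreserving_map (e : H.Edge) : Measure.QuasiMeasurePreserving (H.map e) μ μ :=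
  (𝔪.nonSingular _ (H.map_mem e)).quasiMeasurePreserving

theorem measurable_map (e : H.Edge) : Measurable (H.map e) :=
  (H.quasiMeasurePreserving_map e).measurable

theorem measurable_pathMap (w : List H.Edge) : Measurable (H.pathMap w) := by
  induction w with
  | nil => exact measurable_id
  | cons e w ih => exact ih.comp (H.measurable_map e)

theorem measurableSet_pathDom (w : List H.Edge) : MeasurableSet (H.pathDom w) := by
  induction w with
  | nil => exact MeasurableSet.univ
  | cons e w ih => exact (H.measurableSet_source e).inter (H.measurable_map e ih)

theorem pathMap_append (u v : List H.Edge) : H.pathMap (u ++ v) = H.pathMap v ∘ H.pathMap u := by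
  induction u with
  | nil => rfl
  | cons e u ih => rw [List.cons_append, pathMap, ih, pathMap, Function.comp_assoc]

theorem pathDom_append (u v : List H.Edge) :
    H.pathDom (u ++ v) = H.pathDom u ∩ H.pathMap u ⁻¹' H.pathDom v := by
  induction u with
  | nil => simp [pathDom, pathMap]
  | cons e u ih =>
    rw [List.cons_append, pathDom, ih, pathDom, pathMap, Set.preimage_inter, Set.inter_assoc,
      Set.preimage_comp]

theorem mem_supp_iff {w : List H.Edge} {x : X} :
    x ∈ H.supp w ↔ (∀ i, (H.pathMap w)^[i] x ∈ H.pathDom w) ∧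
      x ∈ Function.periodicPts (H.pathMap w) :=
  mem_stableSet_and_periodic_iff

theorem measurableSet_supp [MeasurableEq X] (w : List H.Edge) : MeasurableSet (H.supp w) := by
  have : H.supp w = (⋂ i, (H.pathMap w)^[i] ⁻¹' H.pathDom w) ∩
      Function.minimalPeriod (H.pathMap w) ⁻¹' (Set.Ioi 0) := by
    ext x
    rw [mem_supp_iff, Set.mem_inter_iff, Set.mem_iInter, Set.mem_preimage, Set.mem_Ioi,
      Function.minimalPeriod_pos_iff_mem_periodicPts]
    rfl
  rw [this]
  have hm := H.measurable_pathMap w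
  exact (MeasurableSet.iInter fun i => hm.iterate i (H.measurableSet_pathDom w)).inter
    (measurable_minimalPeriod hm measurableSet_Ioi)

/-- Cutting a cycle: the first part of the path maps the support of `u ++ v` to that of `v ++ u`,
and preserves the period. -/
theorem pathMap_mem_supp {u v : List H.Edge} {x : X} (hx : x ∈ H.supp (u ++ v)) :
    H.pathMap u x ∈ H.supp (v ++ u) ∧
      Function.minimalPeriod (H.pathMap (v ++ u)) (H.pathMap u x) =
        Function.minimalPeriod (H.pathMap (u ++ v)) x := by
  obtain ⟨hdom, hper⟩ := H.mem_supp_iff.1 hx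
  have h1 : Function.Semiconj (H.pathMap u) (H.pathMap (u ++ v)) (H.pathMap (v ++ u)) := by
    intro y
    simp [pathMap_append]
  have h2 : Function.Semiconj (H.pathMap v) (H.pathMap (v ++ u)) (H.pathMap (u ++ v)) := by
    intro y
    simp [pathMap_append]
  have h3 : ∀ y, H.pathMap v (H.pathMap u y) = H.pathMap (u ++ v) y := fun y => by
    simp [pathMap_append]
  refine ⟨H.mem_supp_iff.2 ⟨fun i => ?_, h1.mapsTo_periodicPts hper⟩, Nat.dvd_antisymm ?_ ?_⟩
  · rw [← (h1.iterate_right i).eq, pathDom_append]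
    have hi := hdom i
    rw [pathDom_append] at hi
    refine ⟨hi.2, ?_⟩
    rw [Set.mem_preimage, h3, ← Function.iterate_succ_apply' (H.pathMap (u ++ v))]
    have hi' := hdom (i + 1)
    rw [pathDom_append] at hi'
    exact hi'.1
  · exact ((Function.isPeriodicPt_minimalPeriod _ _).map h1).minimalPeriod_dvd
  -- For the other divisibility, `φ_v` pushes `φ_u(x)` on to `φ_{uv}(x)`, which has the same period
  -- as `x`.
  · rw [← Function.minimalPeriod_apply hper, ← h3]
    exact ((Function.isPeriodicPt_minimalPeriod _ _).map h2).minimalPeriod_dvd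

theorem pathMap_drop_mem_supp {w : List H.Edge} {j : ℕ} (hj : j ≤ w.length) {x : X}
    (hx : x ∈ H.supp (w.rotate j)) :
    H.pathMap (w.drop j) x ∈ H.supp w ∧
      Function.minimalPeriod (H.pathMap w) (H.pathMap (w.drop j) x) =
        Function.minimalPeriod (H.pathMap (w.rotate j)) x := by
  rw [List.rotate_eq_drop_append_take hj] at hx ⊢
  simpa using H.pathMap_mem_supp hx

theorem pathWeight_append [Monoid Ω] (u v : List H.Edge) :
    H.pathWeight (u ++ v) = H.pathWeight u * H.pathWeight v := by
  simp [pathWeight]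

/-- The integral of `m(ω(π)^ρ) / (|π| ρ)` over the support of the cycle `π`. -/
noncomputable def suppIntegral [Monoid Ω] (m : Ω → ℝ≥0∞) (w : List H.Edge) : ℝ≥0∞ :=
  ∫⁻ x in H.supp w, m (H.pathWeight w ^ Function.minimalPeriod (H.pathMap w) x) /
    ((w.length : ℝ≥0∞) * (Function.minimalPeriod (H.pathMap w) x : ℝ≥0∞)) ∂μ

theorem measurable_weight_minimalPeriod [MeasurableEq X] [Monoid Ω] (m : Ω → ℝ≥0∞)
    (w v : List H.Edge) :
    Measurable fun x => m (H.pathWeight v ^ Function.minimalPeriod (H.pathMap w) x) /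
      ((w.length : ℝ≥0∞) * (Function.minimalPeriod (H.pathMap w) x : ℝ≥0∞)) :=
  (measurable_from_nat (f := fun n : ℕ => m (H.pathWeight v ^ n) /
    ((w.length : ℝ≥0∞) * (n : ℝ≥0∞)))).comp (measurable_minimalPeriod (H.measurable_pathMap w))

end Graphing

/-! ### Traciality and the change of variables -/

/-- `(ab)^(n+1) = a · (ba)^n b`, and traciality moves the leading `a` to the end. -/
theorem IsTracial.pow_mul_comm [Monoid Ω] {m : Ω → ℝ≥0∞} (hm : IsTracial m) (a b : Ω) (n : ℕ) :
    m ((a * b) ^ n) = m ((b * a) ^ n) := by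
  cases n with
  | zero => simp
  | succ n =>
    have h : (a * b) ^ (n + 1) = a * ((b * a) ^ n * b) := by
      rw [_root_.pow_succ, ← mul_assoc, ← mul_assoc]
      congr 1
      exact (SemiconjBy.pow_right (show SemiconjBy a (b * a) (a * b) by
        simp [SemiconjBy, mul_assoc]) n).eq.symm
    rw [h, hm, mul_assoc, ← _root_.pow_succ]

theorem sum_average_eq (c L : ℝ≥0∞) {p : ℕ} (hp : 0 < p) :
    ∑ _k ∈ Finset.range p, c / (L * (p : ℝ≥0∞) * (p : ℝ≥0∞)) = c / (L * (p : ℝ≥0∞)) := by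
  have hp0 : (p : ℝ≥0∞) ≠ 0 := by exact_mod_cast hp.ne'
  have hpt : (p : ℝ≥0∞) ≠ ∞ := ENNReal.natCast_ne_top p
  rw [Finset.sum_const, Finset.card_range, nsmul_eq_mul, ← mul_div_assoc, mul_comm (p : ℝ≥0∞) c]
  exact ENNReal.mul_div_mul_right _ _ hp0 hpt

/-- After the change of variables, `q̄_m` is the sum of the integrals over the supports of all the
cyclic permutations. -/
theorem qbar_eq [MeasurableEq X] [Monoid Ω] {m : Ω → ℝ≥0∞} (hm : IsTracial m) (H : Graphing Ω 𝔪)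
    {π : List H.Edge} (hπ : H.IsOneCycle π) :
    qbar 𝔪 m H π = ∑ j ∈ Finset.range π.length, H.suppIntegral m (π.rotate j) := by
  rw [qbar, if_pos hπ]
  refine Finset.sum_congr rfl fun j hj => ?_
  have hjl : j < π.length := Finset.mem_range.1 hj
  have hdrop := H.measurable_pathMap (π.drop j)
  calc _ = ∫⁻ x in H.supp π, m (H.pathWeight π ^ Function.minimalPeriod (H.pathMap π) x) /
          ((π.length : ℝ≥0∞) * (Function.minimalPeriod (H.pathMap π) x : ℝ≥0∞))
          ∂(Measure.map (H.pathMap (π.drop j)) (μ.restrict (H.supp (π.rotate j)))) := by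
        -- The period is constant along the orbit, so the inner sum consists of `p` equal terms.
        refine setLIntegral_congr_fun (H.measurableSet_supp π) fun x hx => ?_
        obtain ⟨-, hper⟩ := H.mem_supp_iff.1 hx
        simp only [Function.minimalPeriod_apply_iterate hper]
        exact sum_average_eq _ _ (Function.minimalPeriod_pos_of_mem_periodicPts hper)
    _ = ∫⁻ x in H.supp (π.rotate j),
          (H.supp π).indicator (fun x => m (H.pathWeight π ^ Function.minimalPeriod (H.pathMap π) x) /
          ((π.length : ℝ≥0∞) * (Function.minimalPeriod (H.pathMap π) x : ℝ≥0∞)))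
            (H.pathMap (π.drop j) x) ∂μ := by
        rw [← lintegral_indicator (H.measurableSet_supp π), lintegral_map _ hdrop]
        exact (H.measurable_weight_minimalPeriod m π π).indicator (H.measurableSet_supp π)
    _ = H.suppIntegral m (π.rotate j) := by
        refine setLIntegral_congr_fun (H.measurableSet_supp _) fun x hx => ?_
        obtain ⟨h1, h2⟩ := H.pathMap_drop_mem_supp hjl.le hx
        simp only [Set.indicator_of_mem h1, h2, List.length_rotate]
        congr 1
        have hw : H.pathWeight π = H.pathWeight (π.take j) * H.pathWeight (π.drop j) := by
          rw [← H.pathWeight_append, List.take_append_drop]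
        rw [hw, hm.pow_mul_comm, ← H.pathWeight_append, ← List.rotate_eq_drop_append_take hjl.le]

/-! ### Trajectories along infinite edge sequences -/

namespace Graphing

variable (H : Graphing Ω 𝔪)

/-- The trajectory of a point along an infinite sequence of edges. -/
def traj (H : Graphing Ω 𝔪) (s : ℕ → H.Edge) (x : X) : ℕ → X
  | 0 => x
  | n + 1 => H.map (s n) (H.traj s x n)

theorem traj_add (s : ℕ → H.Edge) (x : X) (k n : ℕ) :
    H.traj s x (k + n) = H.traj (shift^[k] s) (H.traj s x k) n := by
  induction n with
  | zero => rfl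
  | succ n ih => rw [← add_assoc, traj, ih, traj, shift_iterate, add_comm n k]

theorem traj_succ_eq (s : ℕ → H.Edge) (x : X) (n : ℕ) :
    H.traj s x (n + 1) = H.traj (shift s) (H.map (s 0) x) n := by
  rw [add_comm, traj_add]
  rfl

theorem pathMap_eq_traj {s : ℕ → H.Edge} {w : List H.Edge}
    (h : ∀ i (hi : i < w.length), w[i] = s i) (x : X) : H.pathMap w x = H.traj s x w.length := by
  induction w generalizing s x with
  | nil => rfl
  | cons e w ih =>
    have h0 : e = s 0 := h 0 (by simp)
    rw [pathMap, List.length_cons, traj_succ_eq, Function.comp_apply, ← h0]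
    exact ih (fun i hi => h (i + 1) (by simpa using hi)) _

theorem mem_pathDom_iff_traj {s : ℕ → H.Edge} {w : List H.Edge}
    (h : ∀ i (hi : i < w.length), w[i] = s i) (x : X) :
    x ∈ H.pathDom w ↔ ∀ i < w.length, H.traj s x i ∈ H.source (s i) := by
  induction w generalizing s x with
  | nil => simp [pathDom]
  | cons e w ih =>
    have h0 : e = s 0 := h 0 (by simp)
    have h1 := ih (s := shift s) (fun i hi => h (i + 1) (by simpa using hi)) (H.map e x)
    rw [pathDom, Set.mem_inter_iff, Set.mem_preimage, h1, List.length_cons, Nat.forall_lt_succ_left]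
    simp only [traj_succ_eq, ← h0]
    rfl

theorem iterate_pathMap {w : List H.Edge} (hw : w ≠ []) (x : X) (n : ℕ) :
    (H.pathMap w)^[n] x = H.traj (cyc w hw) x (n * w.length) := by
  induction n with
  | zero => simp [traj]
  | succ n ih =>
    rw [Function.iterate_succ_apply', ih, Nat.succ_mul, traj_add,
      ((isPeriodicPt_cyc hw).const_mul n).eq]
    exact H.pathMap_eq_traj (fun i hi => (cyc_of_lt hw hi).symm) _

theorem isPeriodicPt_pathMap_iff {w : List H.Edge} (hw : w ≠ []) {x : X} {n : ℕ} :
    Function.IsPeriodicPt (H.pathMap w) n x ↔ H.traj (cyc w hw) x (n * w.length) = x := by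
  rw [Function.IsPeriodicPt, Function.IsFixedPt, iterate_pathMap]

/-- Division by `|w|` unfolds the conditions on iterates of `φ_w` into one condition per edge of the
repeated word. In this form words of different lengths can be compared. -/
theorem mem_supp_iff_traj {w : List H.Edge} (hw : w ≠ []) {x : X} :
    x ∈ H.supp w ↔ (∀ n, H.traj (cyc w hw) x n ∈ H.source (cyc w hw n)) ∧
      x ∈ Function.periodicPts (H.pathMap w) := by
  rw [mem_supp_iff]
  refine and_congr_left fun _ => ?_
  have hl := List.length_pos_iff.2 hw
  have key : ∀ k, (H.pathMap w)^[k] x ∈ H.pathDom w ↔ ∀ i < w.length,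
      H.traj (cyc w hw) x (k * w.length + i) ∈ H.source (cyc w hw (k * w.length + i)) := by
    intro k
    rw [H.mem_pathDom_iff_traj (s := cyc w hw) (fun i hi => (cyc_of_lt hw hi).symm)]
    refine forall₂_congr fun i _ => ?_
    have hp := ((isPeriodicPt_cyc hw).const_mul k)
    rw [traj_add, hp.eq, iterate_pathMap, add_comm, isPeriodicPt_shift_iff.1 hp]
  constructor
  · intro h n
    have := (key (n / w.length)).1 (h _) (n % w.length) (Nat.mod_lt _ hl)
    rwa [mul_comm, Nat.div_add_mod] at this
  · intro h k
    exact (key k).2 fun i _ => h _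

theorem traj_add_of_periodic {s : ℕ → H.Edge} {x : X} {N : ℕ} (hs : Function.IsPeriodicPt shift N s)
    (hx : H.traj s x N = x) (n : ℕ) : H.traj s x (n + N) = H.traj s x n := by
  rw [add_comm, traj_add, hs.eq, hx]

theorem quasiMeasurePreserving_traj (s : ℕ → H.Edge) (n : ℕ) :
    Measure.QuasiMeasurePreserving (fun x => H.traj s x n) μ μ := by
  induction n with
  | zero => exact Measure.QuasiMeasurePreserving.id μ
  | succ n ih => exact (H.quasiMeasurePreserving_map (s n)).comp ih

theorem pathWeight_pow [Monoid Ω] (w : List H.Edge) (n : ℕ) :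
    H.pathWeight (pow w n) = H.pathWeight w ^ n := by
  induction n with
  | zero => simp [pow_zero_eq, pathWeight]
  | succ n ih => rw [pow_succ_eq, pathWeight_append, ih, _root_.pow_succ']

/-- The support of a path that is not a cycle is null. -/
theorem measure_supp_eq_zero {w : List H.Edge} (hw : w ≠ []) {i : ℕ}
    (h : μ (H.target (cyc w hw i) ∩ H.source (cyc w hw (i + 1))) = 0) : μ (H.supp w) = 0 := by
  refine measure_mono_null ?_ ((H.quasiMeasurePreserving_traj (cyc w hw) (i + 1)).preimage_null h)
  intro x hx
  have hx' := ((H.mem_supp_iff_traj hw).1 hx).1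
  exact ⟨⟨_, hx' i, rfl⟩, hx' (i + 1)⟩

/-- The function whose integral is `suppIntegral`. -/
noncomputable def suppIntegrand [Monoid Ω] (m : Ω → ℝ≥0∞) (w : List H.Edge) : X → ℝ≥0∞ :=
  (H.supp w).indicator fun x => m (H.pathWeight w ^ Function.minimalPeriod (H.pathMap w) x) /
    ((w.length : ℝ≥0∞) * (Function.minimalPeriod (H.pathMap w) x : ℝ≥0∞))

theorem lintegral_suppIntegrand [MeasurableEq X] [Monoid Ω] (m : Ω → ℝ≥0∞) (w : List H.Edge) :
    ∫⁻ x, H.suppIntegrand m w x ∂μ = H.suppIntegral m w :=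
  lintegral_indicator (H.measurableSet_supp w) _

theorem measurable_suppIntegrand [MeasurableEq X] [Monoid Ω] (m : Ω → ℝ≥0∞) (w : List H.Edge) :
    Measurable (H.suppIntegrand m w) :=
  (H.measurable_weight_minimalPeriod m w w).indicator (H.measurableSet_supp w)

theorem suppIntegrand_of_notMem [Monoid Ω] (m : Ω → ℝ≥0∞) {w : List H.Edge} {x : X}
    (hx : x ∉ H.supp w) : H.suppIntegrand m w x = 0 :=
  Set.indicator_of_notMem hx _

/-- The cyclic-chain relation of cycles. -/
def meets (e e' : H.Edge) : Prop := 0 < μ (H.target e ∩ H.source e')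

theorem isCycle_iff {w : List H.Edge} : H.IsCycle w ↔ CycChain H.meets w := by
  rw [cycChain_iff, IsCycle, IsPath, and_assoc]
  simp only [Set.inter_comm (H.source _)]
  rfl

/-- Being a cycle depends only on the repetition, so every root of a cycle is itself a cycle. -/
theorem isOneCycle_iff {w : List H.Edge} : H.IsOneCycle w ↔ H.IsCycle w ∧ IsPrim w := by
  refine and_congr_right fun hw => ?_
  rw [H.isCycle_iff] at hw
  rw [isPrim_iff hw.1, not_iff_not]
  constructor
  · rintro ⟨ρ, k, -, hk, rfl⟩
    exact ⟨ρ, k, hk, rfl⟩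
  · rintro ⟨ρ, k, hk, rfl⟩
    exact ⟨ρ, k, H.isCycle_iff.2 ((cycChain_pow_iff (by omega)).1 hw), hk, rfl⟩

end Graphing

/-! ### Lifting periodic orbits to a refinement -/

/-- The points at which the almost-everywhere conditions of a refinement all hold. -/
structure IsRegularPoint (H' H : Graphing Ω 𝔪) (θ : H'.Edge → H.Edge) (y : X) : Prop where
  mem_source : ∀ e, y ∈ H'.source e → y ∈ H.source (θ e)
  exists_mem : ∀ f, y ∈ H.source f → ∃ e, θ e = f ∧ y ∈ H'.source e
  unique : ∀ e e', θ e = θ e' → y ∈ H'.source e → y ∈ H'.source e' → e = e'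
  map_eq : ∀ e, y ∈ H.source (θ e) → y ∈ H'.source e → H.map (θ e) y = H'.map e y

variable {H' H : Graphing Ω 𝔪} {θ : H'.Edge → H.Edge}

theorem IsRefinement.ae_isRegularPoint (h : IsRefinement H' H θ) :
    ∀ᵐ y ∂μ, IsRegularPoint H' H θ y := by
  have := H.countable_edge
  have := H'.countable_edge
  have h1 : ∀ᵐ y ∂μ, ∀ f, y ∈ H.source f ↔ y ∈ ⋃ e ∈ θ ⁻¹' {f}, H'.source e :=
    ae_all_iff.2 fun f => (h.source_eq f).mem_iff
  have h2 : ∀ᵐ y ∂μ, ∀ e e', θ e = θ e' → e ≠ e' → y ∉ H'.source e ∩ H'.source e' := by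
    refine ae_all_iff.2 fun e => ae_all_iff.2 fun e' => ?_
    by_cases hee : θ e = θ e' ∧ e ≠ e'
    · filter_upwards [measure_eq_zero_iff_ae_notMem.1 (h.disjoint_source e e' hee.1 hee.2)]
        with y hy _ _ using hy
    · exact Filter.Eventually.of_forall fun y h1 h2 => absurd ⟨h1, h2⟩ hee
  have h3 := ae_all_iff.2 h.map_eq
  filter_upwards [h1, h2, h3] with y h1 h2 h3
  refine ⟨fun e he => ?_, fun f hf => ?_, fun e e' hee he he' => ?_, fun e he he' => h3 e ⟨he, he'⟩⟩
  · exact (h1 _).2 (Set.mem_biUnion (Set.mem_preimage.2 rfl) he)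
  · obtain ⟨e, he, hy⟩ := Set.mem_iUnion₂.1 ((h1 f).1 hf)
    exact ⟨e, he, hy⟩
  · by_contra hne
    exact h2 e e' hee hne ⟨he, he'⟩

theorem IsRefinement.ae_isRegularPoint_traj (h : IsRefinement H' H θ) (s : ℕ → H.Edge) :
    ∀ᵐ x ∂μ, ∀ n, IsRegularPoint H' H θ (H.traj s x n) :=
  ae_all_iff.2 fun n => (H.quasiMeasurePreserving_traj s n).ae h.ae_isRegularPoint

theorem IsRefinement.meets (h : IsRefinement H' H θ) {a b : H'.Edge} (hab : H'.meets a b) :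
    H.meets (θ a) (θ b) := by
  refine lt_of_lt_of_le hab (measure_mono_ae ?_)
  filter_upwards [(h.target_eq (θ a)).mem_iff, (h.source_eq (θ b)).mem_iff] with y h1 h2 hy
  exact ⟨h1.2 (Set.mem_biUnion (Set.mem_preimage.2 rfl) hy.1),
    h2.2 (Set.mem_biUnion (Set.mem_preimage.2 rfl) hy.2)⟩

theorem traj_eq_of_mem_source {s : ℕ → H.Edge} {x : X}
    (hx : ∀ n, IsRegularPoint H' H θ (H.traj s x n)) {t : ℕ → H'.Edge} (ht : θ ∘ t = s)
    (h : ∀ n, H'.traj t x n ∈ H'.source (t n)) (n : ℕ) : H'.traj t x n = H.traj s x n := by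
  induction n with
  | zero => rfl
  | succ n ih =>
    have hn := h n
    rw [ih] at hn
    rw [Graphing.traj, Graphing.traj, ih, ← (hx n).map_eq (t n) ((hx n).mem_source _ hn) hn, ← ht]
    rfl

theorem traj_eq_of_mem_source' {s : ℕ → H.Edge} {x : X}
    (hx : ∀ n, IsRegularPoint H' H θ (H.traj s x n)) {t : ℕ → H'.Edge} (ht : θ ∘ t = s)
    (h : ∀ n, H.traj s x n ∈ H'.source (t n)) (n : ℕ) : H'.traj t x n = H.traj s x n := by
  induction n with
  | zero => rfl
  | succ n ih =>
    rw [Graphing.traj, Graphing.traj, ih,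
      ← (hx n).map_eq (t n) ((hx n).mem_source _ (h n)) (h n), ← ht]
    rfl

theorem mem_source_unique {s : ℕ → H.Edge} {x : X}
    (hx : ∀ n, IsRegularPoint H' H θ (H.traj s x n)) {t t' : ℕ → H'.Edge} (ht : θ ∘ t = θ ∘ t')
    (h : ∀ n, H.traj s x n ∈ H'.source (t n)) (h' : ∀ n, H.traj s x n ∈ H'.source (t' n)) :
    t = t' :=
  funext fun n => (hx n).unique _ _ (congrFun ht n) (h n) (h' n)

/-- At a regular point, the support of a primitive word above `π` is contained in that of `π`, and
the total lengths of the periodic orbits are the same. -/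
theorem mem_supp_of_mem_supp_lift {π : List H.Edge} (hπ : π ≠ []) {x : X}
    (hx : ∀ n, IsRegularPoint H' H θ (H.traj (cyc π hπ) x n)) {w : List H'.Edge} (hw : IsPrim w)
    (hwπ : θ ∘ cyc w hw.1 = cyc π hπ) (hπp : IsPrim π) (hxw : x ∈ H'.supp w) :
    x ∈ H.supp π ∧ w.length * Function.minimalPeriod (H'.pathMap w) x =
      π.length * Function.minimalPeriod (H.pathMap π) x := by
  obtain ⟨hsrc, hper⟩ := (H'.mem_supp_iff_traj hw.1).1 hxw
  have htraj := traj_eq_of_mem_source hx hwπ hsrc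
  simp only [htraj] at hsrc
  -- `|w|` is a period of the repetition of `w`, hence of its image, whose minimal period is `|π|`.
  obtain ⟨k, hk⟩ : π.length ∣ w.length := by
    rw [← hπp.2, ← hwπ]
    refine Function.IsPeriodicPt.minimalPeriod_dvd (isPeriodicPt_shift_iff.2 fun i => ?_)
    exact congrArg θ (isPeriodicPt_shift_iff.1 (isPeriodicPt_cyc hw.1) i)
  have hk0 : 0 < k := by
    have := List.length_pos_iff.2 hw.1
    rw [hk] at this
    exact Nat.pos_of_mul_pos_left this
  have hpw := Function.minimalPeriod_pos_of_mem_periodicPts hper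
  set p' := Function.minimalPeriod (H'.pathMap w) x
  have h1 : Function.IsPeriodicPt (H.pathMap π) (p' * k) x := by
    rw [H.isPeriodicPt_pathMap_iff hπ, mul_assoc, mul_comm k, ← hk, ← htraj,
      ← H'.isPeriodicPt_pathMap_iff hw.1]
    exact Function.isPeriodicPt_minimalPeriod _ _
  have hperπ : x ∈ Function.periodicPts (H.pathMap π) := ⟨_, Nat.mul_pos hpw hk0, h1⟩
  refine ⟨(H.mem_supp_iff_traj hπ).2 ⟨fun n => ?_, hperπ⟩, ?_⟩
  · rw [← hwπ]
    rw [← hwπ] at hsrc hx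
    exact (hx n).mem_source _ (hsrc n)
  set p := Function.minimalPeriod (H.pathMap π) x with hp
  have hN : H.traj (cyc π hπ) x (p * π.length) = x :=
    (H.isPeriodicPt_pathMap_iff hπ).1 (Function.isPeriodicPt_minimalPeriod _ _)
  have hNs : Function.IsPeriodicPt shift (p * π.length) (cyc π hπ) :=
    (isPeriodicPt_cyc hπ).const_mul p
  -- After `p |π|` steps both the point and the sequence below have returned; uniqueness of the
  -- refined edge at each regular point makes the sequence above return too.
  obtain ⟨l, hl⟩ : w.length ∣ p * π.length := by
    rw [← hw.2]
    refine Function.IsPeriodicPt.minimalPeriod_dvd (isPeriodicPt_shift_iff.2 fun i => ?_)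
    refine (hx i).unique _ _ ?_ ?_ (hsrc i)
    · have := isPeriodicPt_shift_iff.1 hNs i
      rw [← hwπ] at this
      exact this
    · have := hsrc (i + p * π.length)
      rwa [H.traj_add_of_periodic hNs hN] at this
  have h2 : p' ∣ l := by
    refine Function.IsPeriodicPt.minimalPeriod_dvd ((H'.isPeriodicPt_pathMap_iff hw.1).2 ?_)
    rw [htraj, mul_comm, ← hl, hN]
  refine Nat.dvd_antisymm ?_ ?_
  · rw [mul_comm π.length, hl]
    exact Nat.mul_dvd_mul_left _ h2
  · rw [hk, mul_assoc, mul_comm k]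
    exact Nat.mul_dvd_mul_left _ h1.minimalPeriod_dvd

/-- A regular point of the support of `π` lies in the support of a primitive word above `π`. -/
theorem exists_mem_supp_lift {π : List H.Edge} (hπ : π ≠ []) {x : X}
    (hx : ∀ n, IsRegularPoint H' H θ (H.traj (cyc π hπ) x n)) (hxπ : x ∈ H.supp π) :
    ∃ (w : List H'.Edge) (hw : IsPrim w), θ ∘ cyc w hw.1 = cyc π hπ ∧ x ∈ H'.supp w := by
  obtain ⟨hsrc, hper⟩ := (H.mem_supp_iff_traj hπ).1 hxπ
  choose t htθ htsrc using fun n => (hx n).exists_mem _ (hsrc n)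
  have hp := Function.minimalPeriod_pos_of_mem_periodicPts hper
  set p := Function.minimalPeriod (H.pathMap π) x
  have hN : H.traj (cyc π hπ) x (p * π.length) = x :=
    (H.isPeriodicPt_pathMap_iff hπ).1 (Function.isPeriodicPt_minimalPeriod _ _)
  have hNs : Function.IsPeriodicPt shift (p * π.length) (cyc π hπ) :=
    (isPeriodicPt_cyc hπ).const_mul p
  have hN0 : 0 < p * π.length := Nat.mul_pos hp (List.length_pos_iff.2 hπ)
  -- The chosen edges are periodic because at a regular point only one edge is available above a
  -- given edge.
  have htper : Function.IsPeriodicPt shift (p * π.length) t := by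
    refine isPeriodicPt_shift_iff.2 fun i => (hx i).unique _ _ ?_ ?_ (htsrc i)
    · rw [htθ, htθ, isPeriodicPt_shift_iff.1 hNs]
    · have := htsrc (i + p * π.length)
      rwa [H.traj_add_of_periodic hNs hN] at this
  obtain ⟨w, hw, rfl⟩ := exists_isPrim_cyc_eq ⟨_, hN0, htper⟩
  have hθ : θ ∘ cyc w hw.1 = cyc π hπ := funext htθ
  have htraj := traj_eq_of_mem_source' hx hθ htsrc
  refine ⟨w, hw, hθ, (H'.mem_supp_iff_traj hw.1).2 ⟨fun n => by rw [htraj]; exact htsrc n, ?_⟩⟩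
  obtain ⟨l, hl⟩ : w.length ∣ p * π.length := by
    rw [← hw.2]
    exact htper.minimalPeriod_dvd
  refine ⟨l, ?_, ?_⟩
  · rw [hl] at hN0
    exact Nat.pos_of_mul_pos_left hN0
  · rw [H'.isPeriodicPt_pathMap_iff hw.1, htraj, mul_comm, ← hl, hN]

theorem eq_of_mem_supp_lift {π : List H.Edge} (hπ : π ≠ []) {x : X}
    (hx : ∀ n, IsRegularPoint H' H θ (H.traj (cyc π hπ) x n)) {w v : List H'.Edge}
    (hw : IsPrim w) (hv : IsPrim v) (hwπ : θ ∘ cyc w hw.1 = cyc π hπ)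
    (hvπ : θ ∘ cyc v hv.1 = cyc π hπ) (hxw : x ∈ H'.supp w) (hxv : x ∈ H'.supp v) : w = v := by
  have h1 := ((H'.mem_supp_iff_traj hw.1).1 hxw).1
  have h2 := ((H'.mem_supp_iff_traj hv.1).1 hxv).1
  have e1 := traj_eq_of_mem_source hx hwπ h1
  have e2 := traj_eq_of_mem_source hx hvπ h2
  simp only [e1] at h1
  simp only [e2] at h2
  exact hw.eq_of_cyc_eq hv (mem_source_unique hx (hwπ.trans hvπ.symm) h1 h2)

/-- The image of `w^a` and the word `π^b` have the same length and the same repetition, so they are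
the same word. -/
theorem IsRefinement.pathWeight_pow_eq [Monoid Ω] (h : IsRefinement H' H θ) {π : List H.Edge}
    (hπ : π ≠ []) {w : List H'.Edge} (hw : w ≠ []) (hwπ : θ ∘ cyc w hw = cyc π hπ) {a b : ℕ}
    (hab : w.length * a = π.length * b) : H'.pathWeight w ^ a = H.pathWeight π ^ b := by
  have hmap : w.map θ ≠ [] := by simpa using hw
  have h1 : H'.pathWeight w = H.pathWeight (w.map θ) := by
    simp only [Graphing.pathWeight, List.map_map]
    congr 2
    funext e
    exact (h.weight_eq e).symm
  have hlen : (pow (w.map θ) a).length = (pow π b).length := by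
    rw [length_pow, length_pow, List.length_map, mul_comm, hab, mul_comm]
  rw [h1, ← Graphing.pathWeight_pow, ← Graphing.pathWeight_pow]
  congr 1
  rcases Nat.eq_zero_or_pos b with rfl | hb
  · rw [pow_zero_eq, List.length_nil] at hlen
    rw [List.length_eq_zero_iff.1 hlen, pow_zero_eq]
  · have hb' := pow_ne_nil hπ hb
    have ha' : pow (w.map θ) a ≠ [] := by
      rw [← List.length_pos_iff, hlen]
      exact List.length_pos_iff.2 hb'
    exact eq_of_cyc_eq ha' hb' hlen (by rw [cyc_pow hmap, cyc_pow hπ, cyc_map θ hw, hwπ])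

/-- The integral over the support of a primitive word is the sum of the integrals over the supports
of the primitive cycles above it. -/
theorem IsRefinement.suppIntegral_eq_tsum [MeasurableEq X] [Monoid Ω] (h : IsRefinement H' H θ)
    (m : Ω → ℝ≥0∞) {π : List H.Edge} (hπ : IsPrim π) {r' : H'.Edge → H'.Edge → Prop}
    (hr' : ∀ w : List H'.Edge, ∀ hw : w ≠ [], θ ∘ cyc w hw = cyc π hπ.1 → H'.IsCycle w →
      CycChain r' w) :
    H.suppIntegral m π = ∑' w : primAbove r' θ (cyc π hπ.1), H'.suppIntegral m w.1 := by
  have := H'.countable_edge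
  -- `P` omits the chain condition of `primAbove`, so that the pointwise identity covers every
  -- regular point of `supp π`; words of `P` outside `primAbove` are discarded at the end.
  obtain ⟨P, hPmem⟩ : ∃ P : Set (List H'.Edge),
      ∀ w, w ∈ P ↔ ∃ hw : IsPrim w, θ ∘ cyc w hw.1 = cyc π hπ.1 :=
    ⟨{w | ∃ hw : IsPrim w, θ ∘ cyc w hw.1 = cyc π hπ.1}, fun _ => Iff.rfl⟩
  have hpt : ∀ᵐ x ∂μ, H.suppIntegrand m π x = ∑' w : P, H'.suppIntegrand m w.1 x := by
    filter_upwards [h.ae_isRegularPoint_traj (cyc π hπ.1)] with x hx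
    by_cases hxπ : x ∈ H.supp π
    · obtain ⟨w, hw, hwπ, hxw⟩ := exists_mem_supp_lift hπ.1 hx hxπ
      have hwP : w ∈ P := (hPmem w).2 ⟨hw, hwπ⟩
      have huniq : ∀ v : P, v ≠ ⟨w, hwP⟩ → H'.suppIntegrand m v.1 x = 0 := by
        rintro ⟨v, hvP⟩ hne
        obtain ⟨hv, hvπ⟩ := (hPmem v).1 hvP
        refine H'.suppIntegrand_of_notMem m fun hxv => hne (Subtype.ext ?_)
        exact eq_of_mem_supp_lift hπ.1 hx hv hw hvπ hwπ hxv hxw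
      obtain ⟨-, hl⟩ := mem_supp_of_mem_supp_lift hπ.1 hx hw hwπ hπ hxw
      rw [tsum_eq_single ⟨w, hwP⟩ huniq, Graphing.suppIntegrand, Graphing.suppIntegrand,
        Set.indicator_of_mem hxπ, Set.indicator_of_mem hxw,
        h.pathWeight_pow_eq hπ.1 hw.1 hwπ hl, ← Nat.cast_mul, ← Nat.cast_mul, hl]
    · rw [H.suppIntegrand_of_notMem m hxπ, eq_comm, ENNReal.tsum_eq_zero]
      rintro ⟨w, hwP⟩
      obtain ⟨hw, hwπ⟩ := (hPmem w).1 hwP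
      exact H'.suppIntegrand_of_notMem m
        fun hxw => hxπ (mem_supp_of_mem_supp_lift hπ.1 hx hw hwπ hπ hxw).1
  have hP : H.suppIntegral m π = ∑' w : P, H'.suppIntegral m w.1 := by
    calc H.suppIntegral m π = ∫⁻ x, H.suppIntegrand m π x ∂μ := (H.lintegral_suppIntegrand m π).symm
      _ = ∫⁻ x, ∑' w : P, H'.suppIntegrand m w.1 x ∂μ := lintegral_congr_ae hpt
      _ = ∑' w : P, ∫⁻ x, H'.suppIntegrand m w.1 x ∂μ :=
        lintegral_tsum fun w => (H'.measurable_suppIntegrand m w.1).aemeasurable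
      _ = ∑' w : P, H'.suppIntegral m w.1 :=
        tsum_congr fun w => H'.lintegral_suppIntegrand m w.1
  rw [hP, tsum_subtype P (H'.suppIntegral m), tsum_subtype (primAbove r' θ (cyc π hπ.1))
    (H'.suppIntegral m)]
  refine tsum_congr fun w => ?_
  by_cases hw : w ∈ P
  · by_cases hwr : w ∈ primAbove r' θ (cyc π hπ.1)
    · rw [Set.indicator_of_mem hw, Set.indicator_of_mem hwr]
    · rw [Set.indicator_of_mem hw, Set.indicator_of_notMem hwr]
      obtain ⟨hprim, hwπ⟩ := (hPmem w).1 hw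
      -- By `hr'`, a word of `P` outside `primAbove` is not a cycle, so its support is null.
      have hnc : ¬ CycChain H'.meets w := fun hc =>
        hwr ⟨hprim, hr' w hprim.1 hwπ (H'.isCycle_iff.2 hc), hwπ⟩
      simp only [CycChain, not_exists, not_forall] at hnc
      obtain ⟨i, hi⟩ := hnc hprim.1
      exact setLIntegral_measure_zero _ _
        (H'.measure_supp_eq_zero hprim.1 (le_antisymm (not_lt.1 hi) bot_le))
  · have hwr : w ∉ primAbove r' θ (cyc π hπ.1) := by
      rintro ⟨h1, h2, h3⟩
      exact hw ((hPmem w).2 ⟨h1, h3⟩)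
    rw [Set.indicator_of_notMem hw, Set.indicator_of_notMem hwr]

/-! ### Pluggings and alternating cycles -/

theorem biUnion_map_preimage_inl {X E E' E'' : Type*} (θ : E' → E) (S : E' ⊕ E'' → Set X) (f : E) :
    ⋃ e ∈ Sum.map θ (id : E'' → E'') ⁻¹' {Sum.inl f}, S e = ⋃ e ∈ θ ⁻¹' {f}, S (Sum.inl e) := by
  ext x
  simp

theorem biUnion_map_preimage_inr {X E E' E'' : Type*} (θ : E' → E) (S : E' ⊕ E'' → Set X) (f : E'') :
    ⋃ e ∈ Sum.map θ (id : E'' → E'') ⁻¹' {Sum.inr f}, S e = S (Sum.inr f) := by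
  ext x
  simp

/-- Realisers are determined only on their sources. An orbit that stays in the domain never sees the
values outside it, so renaming preserves supports and periods. -/
theorem iterate_eq_of_eqOn {X : Type*} {f g : X → X} {D : Set X} (h : Set.EqOn f g D) {x : X}
    (hx : ∀ i, g^[i] x ∈ D) (n : ℕ) : f^[n] x = g^[n] x := by
  induction n with
  | zero => rfl
  | succ n ih => rw [Function.iterate_succ_apply', Function.iterate_succ_apply', ih, h (hx n)]

theorem minimalPeriod_eq_of_iterate_eq {X : Type*} {f g : X → X} {x : X} (h : ∀ n, f^[n] x = g^[n] x) :
    Function.minimalPeriod f x = Function.minimalPeriod g x :=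
  Function.minimalPeriod_eq_minimalPeriod_iff.2 fun n => by
    rw [Function.IsPeriodicPt, Function.IsFixedPt, h n]
    rfl

theorem IsRefinement.plug {F' F : Graphing Ω 𝔪} {θ : F'.Edge → F.Edge} (h : IsRefinement F' F θ)
    (G : Graphing Ω 𝔪) : IsRefinement (F'.plug G) (F.plug G) (Sum.map θ id) where
  disjoint_source := by
    rintro (e | e) (e' | e') hee hne
    · exact h.disjoint_source e e' (Sum.inl_injective hee) fun h' => hne (congrArg _ h')
    · simp at hee
    · simp at hee
    · exact absurd (congrArg Sum.inr (Sum.inr_injective hee)) hne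
  disjoint_target := by
    rintro (e | e) (e' | e') hee hne
    · exact h.disjoint_target e e' (Sum.inl_injective hee) fun h' => hne (congrArg _ h')
    · simp at hee
    · simp at hee
    · exact absurd (congrArg Sum.inr (Sum.inr_injective hee)) hne
  weight_eq := by
    rintro (e | e)
    · exact h.weight_eq e
    · rfl
  source_eq := by
    rintro (f | f)
    · exact (h.source_eq f).trans (Filter.EventuallyEq.of_eq
        (biUnion_map_preimage_inl θ (F'.plug G).source f).symm)
    · exact Filter.EventuallyEq.of_eq (biUnion_map_preimage_inr θ (F'.plug G).source f).symm
  target_eq := by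
    rintro (f | f)
    · exact (h.target_eq f).trans (Filter.EventuallyEq.of_eq
        (biUnion_map_preimage_inl θ (F'.plug G).target f).symm)
    · exact Filter.EventuallyEq.of_eq (biUnion_map_preimage_inr θ (F'.plug G).target f).symm
  map_eq := by
    rintro (e | e)
    · exact h.map_eq e
    · exact Filter.Eventually.of_forall fun _ _ => rfl

/-- The cyclic-chain relation of alternating cycles. -/
def altMeets (F G : Graphing Ω 𝔪) (e e' : F.Edge ⊕ G.Edge) : Prop :=
  (F.plug G).meets e e' ∧ e.isLeft ≠ e'.isLeft

theorem cycChain_and_iff {E : Type*} {r r' : E → E → Prop} {w : List E} :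
    CycChain (fun a b => r a b ∧ r' a b) w ↔ CycChain r w ∧ CycChain r' w :=
  ⟨fun ⟨h, H⟩ => ⟨⟨h, fun i => (H i).1⟩, h, fun i => (H i).2⟩,
    fun ⟨⟨h, H⟩, _, H'⟩ => ⟨h, fun i => ⟨H i, H' i⟩⟩⟩

theorem isAltCycle_iff {F G : Graphing Ω 𝔪} {w : List (F.Edge ⊕ G.Edge)} :
    IsAltCycle F G w ↔ CycChain (altMeets F G) w := by
  have h1 : CycChain (altMeets F G) w ↔ CycChain (F.plug G).meets w ∧
      CycChain (fun e e' : F.Edge ⊕ G.Edge => e.isLeft ≠ e'.isLeft) w := cycChain_and_iff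
  rw [h1]
  have h2 : w ≠ [] → ((w.IsChain (fun e e' => e.isLeft ≠ e'.isLeft) ∧
      ∀ h : w ≠ [], (w.head h).isLeft ≠ (w.getLast h).isLeft) ↔
      CycChain (fun e e' : F.Edge ⊕ G.Edge => e.isLeft ≠ e'.isLeft) w) := by
    intro hw
    rw [cycChain_iff, and_iff_right hw]
    exact and_congr_right fun _ => forall_congr' fun _ => ne_comm
  exact ⟨fun ⟨hc, ha⟩ => ⟨(F.plug G).isCycle_iff.1 hc, (h2 hc.1.1).1 ha⟩,
    fun ⟨hc, ha⟩ => ⟨(F.plug G).isCycle_iff.2 hc, (h2 hc.1).2 ha⟩⟩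

theorem IsRepChoice.isReps {F G : Graphing Ω 𝔪} {R : Set (List (F.Edge ⊕ G.Edge))}
    (hR : IsRepChoice F G R) : IsReps (altMeets F G) R :=
  ⟨fun π hπ => isAltCycle_iff.1 (hR.altCycle π hπ),
    fun ρ hρ => hR.existsUnique ρ (isAltCycle_iff.2 hρ), hR.root_mem⟩

theorem IsReps.isRepChoice {F G : Graphing Ω 𝔪} {R : Set (List (F.Edge ⊕ G.Edge))}
    (hR : IsReps (altMeets F G) R) : IsRepChoice F G R :=
  ⟨fun π hπ => isAltCycle_iff.2 (hR.cycChain π hπ),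
    fun ρ hρ => hR.existsUnique ρ (isAltCycle_iff.1 hρ), hR.root_mem⟩

theorem qbar_eq_rotSum [MeasurableEq X] [Monoid Ω] {m : Ω → ℝ≥0∞} (hm : IsTracial m)
    (H : Graphing Ω 𝔪) {w : List H.Edge} (hw : H.IsCycle w) :
    qbar 𝔪 m H w = rotSum (H.suppIntegral m) w := by
  by_cases h : IsPrim w
  · rw [qbar_eq hm H (H.isOneCycle_iff.2 ⟨hw, h⟩), rotSum, if_pos h]
  · rw [qbar, if_neg fun h' => h (H.isOneCycle_iff.1 h').2, rotSum, if_neg h]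

/-! ### Invariance under cyclic permutation -/

section Rotation

variable {E : Type*}

theorem sum_rotate_one (J : List E → ℝ≥0∞) (w : List E) :
    ∑ j ∈ Finset.range w.length, J ((w.rotate 1).rotate j) =
      ∑ j ∈ Finset.range w.length, J (w.rotate j) := by
  simp only [List.rotate_rotate, add_comm 1]
  cases h : w.length with
  | zero => simp
  | succ n =>
    rw [Finset.sum_range_succ, Finset.sum_range_succ' (fun j => J (w.rotate j)), ← h,
      List.rotate_length, List.rotate_zero]

theorem isPrim_rotate_iff {w : List E} {i : ℕ} : IsPrim (w.rotate i) ↔ IsPrim w := by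
  refine ⟨fun h => ?_, fun h => h.rotate i⟩
  obtain ⟨j, hj⟩ : List.IsRotated (w.rotate i) w := List.IsRotated.symm ⟨i, rfl⟩
  rw [← hj]
  exact h.rotate j

theorem rotSum_congr {E' : Type*} {J : List E → ℝ≥0∞} {J' : List E' → ℝ≥0∞} {u : List E}
    {v : List E'} (hp : IsPrim u ↔ IsPrim v)
    (hs : ∑ j ∈ Finset.range u.length, J (u.rotate j) =
      ∑ j ∈ Finset.range v.length, J' (v.rotate j)) : rotSum J u = rotSum J' v := by
  by_cases h : IsPrim v
  · rw [rotSum, rotSum, if_pos h, if_pos (hp.2 h), hs]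
  · rw [rotSum, rotSum, if_neg h, if_neg (mt hp.1 h)]

theorem rotSum_rotate (J : List E → ℝ≥0∞) (w : List E) (i : ℕ) :
    rotSum J (w.rotate i) = rotSum J w := by
  have hsum : ∑ j ∈ Finset.range w.length, J ((w.rotate i).rotate j) =
      ∑ j ∈ Finset.range w.length, J (w.rotate j) := by
    induction i with
    | zero => simp
    | succ i ih =>
      rw [← ih, ← List.rotate_rotate]
      simpa only [List.length_rotate] using sum_rotate_one J (w.rotate i)
  exact rotSum_congr isPrim_rotate_iff (by rw [List.length_rotate, hsum])

end Rotation

/-! ### Invariance under renaming of edges -/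

section Renaming

theorem isPrim_map_iff {E E' : Type*} {σ : E → E'} {w : List E} (hσ : Set.InjOn σ {e | e ∈ w}) :
    IsPrim (w.map σ) ↔ IsPrim w := by
  rcases eq_or_ne w [] with rfl | hw
  · exact ⟨fun h => absurd rfl h.1, fun h => absurd rfl h.1⟩
  have hw' : w.map σ ≠ [] := by simpa using hw
  have hmem : ∀ i, cyc w hw i ∈ w := fun i => List.getElem_mem _
  have hp : Function.minimalPeriod shift (cyc (w.map σ) hw') =
      Function.minimalPeriod shift (cyc w hw) := by
    rw [Function.minimalPeriod_eq_minimalPeriod_iff]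
    intro n
    rw [isPeriodicPt_shift_iff, isPeriodicPt_shift_iff, cyc_map σ hw]
    exact forall_congr' fun i => hσ.eq_iff (hmem _) (hmem _)
  constructor
  · intro h
    exact ⟨hw, by rw [← hp, h.2, List.length_map]⟩
  · intro h
    exact ⟨hw', by rw [hp, h.2, List.length_map]⟩

variable {H H' : Graphing Ω 𝔪} {σ : H.Edge → H'.Edge}

/-- `σ` preserves the weight, the source and the realiser of the edge `e`. -/
def PreservesEdge (σ : H.Edge → H'.Edge) (e : H.Edge) : Prop :=
  H'.weight (σ e) = H.weight e ∧ H'.source (σ e) = H.source e ∧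
    Set.EqOn (H'.map (σ e)) (H.map e) (H.source e)

theorem PreservesEdge.target_eq {e : H.Edge} (h : PreservesEdge σ e) :
    H'.target (σ e) = H.target e := by
  rw [Graphing.target, h.2.1, h.2.2.image_eq, Graphing.target]

theorem pathDom_map_and_eqOn {w : List H.Edge} (h : ∀ e ∈ w, PreservesEdge σ e) :
    H'.pathDom (w.map σ) = H.pathDom w ∧
      Set.EqOn (H'.pathMap (w.map σ)) (H.pathMap w) (H.pathDom w) := by
  induction w with
  | nil => exact ⟨rfl, fun _ _ => rfl⟩
  | cons e w ih =>
    obtain ⟨ih1, ih2⟩ := ih fun e' he' => h e' (List.mem_cons_of_mem _ he')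
    obtain ⟨-, hs, hm⟩ := h e List.mem_cons_self
    constructor
    · rw [List.map_cons, Graphing.pathDom, Graphing.pathDom, ih1, hs]
      ext x
      refine and_congr_right fun hx => ?_
      rw [Set.mem_preimage, Set.mem_preimage, hm hx]
    · intro x hx
      rw [List.map_cons, Graphing.pathMap, Graphing.pathMap, Function.comp_apply,
        Function.comp_apply, hm hx.1]
      exact ih2 hx.2

theorem supp_map_eq {w : List H.Edge} (h : ∀ e ∈ w, PreservesEdge σ e) :
    H'.supp (w.map σ) = H.supp w := by
  obtain ⟨h1, h2⟩ := pathDom_map_and_eqOn h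
  ext x
  rw [Graphing.mem_supp_iff, Graphing.mem_supp_iff, h1,
    ← Function.minimalPeriod_pos_iff_mem_periodicPts,
    ← Function.minimalPeriod_pos_iff_mem_periodicPts]
  constructor
  · rintro ⟨hd, hp⟩
    have hit := iterate_eq_of_eqOn h2.symm hd
    exact ⟨fun i => hit i ▸ hd i, minimalPeriod_eq_of_iterate_eq hit ▸ hp⟩
  · rintro ⟨hd, hp⟩
    have hit := iterate_eq_of_eqOn h2 hd
    exact ⟨fun i => hit i ▸ hd i, minimalPeriod_eq_of_iterate_eq hit ▸ hp⟩

theorem suppIntegral_map_eq [MeasurableEq X] [Monoid Ω] (m : Ω → ℝ≥0∞) {w : List H.Edge}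
    (h : ∀ e ∈ w, PreservesEdge σ e) : H'.suppIntegral m (w.map σ) = H.suppIntegral m w := by
  have hw : H'.pathWeight (w.map σ) = H.pathWeight w := by
    rw [Graphing.pathWeight, Graphing.pathWeight, List.map_map]
    exact congrArg List.prod (List.map_congr_left fun e he => (h e he).1)
  rw [Graphing.suppIntegral, Graphing.suppIntegral, supp_map_eq h, hw, List.length_map]
  refine setLIntegral_congr_fun (H.measurableSet_supp w) fun x hx => ?_
  have hit := iterate_eq_of_eqOn (pathDom_map_and_eqOn h).2 (H.mem_supp_iff.1 hx).1
  simp only [minimalPeriod_eq_of_iterate_eq hit]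

theorem isCycle_map {w : List H.Edge} (h : ∀ e ∈ w, PreservesEdge σ e) (hw : H.IsCycle w) :
    H'.IsCycle (w.map σ) := by
  rw [Graphing.isCycle_iff] at hw ⊢
  have hmem : ∀ i, cyc w hw.1 i ∈ w := fun i => List.getElem_mem _
  refine ⟨by simpa using hw.1, fun i => ?_⟩
  rw [cyc_map σ hw.1, Graphing.meets, Function.comp_apply, Function.comp_apply,
    (h _ (hmem i)).target_eq, (h _ (hmem (i + 1))).2.1]
  exact hw.2 i

theorem qbar_map_eq [MeasurableEq X] [Monoid Ω] {m : Ω → ℝ≥0∞} (hm : IsTracial m)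
    {w : List H.Edge} (hw : H.IsCycle w) (hσ : Set.InjOn σ {e | e ∈ w})
    (h : ∀ e ∈ w, PreservesEdge σ e) : qbar 𝔪 m H' (w.map σ) = qbar 𝔪 m H w := by
  rw [qbar_eq_rotSum hm H' (isCycle_map h hw), qbar_eq_rotSum hm H hw]
  have hJ : ∀ j, H'.suppIntegral m ((w.map σ).rotate j) = H.suppIntegral m (w.rotate j) := by
    intro j
    rw [← List.map_rotate]
    exact suppIntegral_map_eq m fun e he => h e (List.mem_rotate.1 he)
  exact rotSum_congr (isPrim_map_iff hσ) (by simp only [List.length_map, hJ])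

end Renaming

/-! ### Refinement-invariance and conclusion -/

theorem isRefinementInvariant_qbar [MeasurableEq X] [Monoid Ω] {m : Ω → ℝ≥0∞} (hm : IsTracial m) :
    IsRefinementInvariant 𝔪 (qbar (Ω := Ω) 𝔪 m) := by
  intro F G F' θ hθ R hR
  have href := hθ.1.plug G
  have hleft : ∀ e : F'.Edge ⊕ G.Edge, (Sum.map θ id e).isLeft = e.isLeft := by
    rintro (e | e) <;> rfl
  obtain ⟨R', hR', hRR'⟩ := hR.isReps.exists_lift (r' := altMeets F' G) (Sum.map θ id)
    fun a b hab => ⟨href.meets hab.1, by rw [hleft, hleft]; exact hab.2⟩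
  refine ⟨R', hR'.isRepChoice, fun π hπ hπ1 => ?_⟩
  have hprim : IsPrim π := ((F.plug G).isOneCycle_iff.1 hπ1).2
  by_cases hmem : π ∈ R
  · have hl : ∑' ρ : powersIn R π, qbar 𝔪 m (F.plug G) ρ.1 =
        ∑' ρ : powersIn R π, rotSum ((F.plug G).suppIntegral m) ρ.1 :=
      tsum_congr fun ρ => qbar_eq_rotSum hm _ (hR.altCycle _ ρ.2.2).1
    have hr : ∑' ρ : cyclesAbove G θ R R' π, qbar 𝔪 m (F'.plug G) ρ.1 =
        ∑' ρ : cyclesAbove G θ R R' π, rotSum ((F'.plug G).suppIntegral m) ρ.1 :=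
      tsum_congr fun ρ => qbar_eq_rotSum hm _ (hR'.isRepChoice.altCycle _ ρ.2.1).1
    refine hl.trans (((tsum_powersIn_rotSum _ hprim hmem).trans ?_).trans hr.symm)
    refine hR.isReps.tsum_lift_rotSum hR' hRR' _ _ hprim hmem fun j hj => ?_
    refine href.suppIntegral_eq_tsum m (hprim.rotate j) fun w hw hwπ hc => ?_
    have hπj := (isAltCycle_iff.1 hπ).rotate j
    refine ⟨hw, fun i => ⟨((F'.plug G).isCycle_iff.1 hc).2 i, ?_⟩⟩
    -- Edges above `π` keep their colours, so a cycle above a rotation of `π` alternates as well.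
    have he : ∀ n, (cyc (π.rotate j) hj n).isLeft = Sum.isLeft (cyc w hw n) := fun n =>
      (congrArg Sum.isLeft (congrFun hwπ n)).symm.trans (hleft _)
    exact fun heq => (hπj.2 i).2 ((he i).trans (heq.trans (he (i + 1)).symm))
  -- If `π` is not a representative, none of its powers is one, and both sums are empty.
  · have h1 : ∀ ρ, ρ ∉ powersIn R π := by
      rintro _ ⟨⟨k, rfl⟩, hk⟩
      exact hmem (hR.root_mem π k hk)
    have : IsEmpty (powersIn R π) := ⟨fun ρ => h1 _ ρ.2⟩
    have : IsEmpty (cyclesAbove G θ R R' π) := ⟨fun ρ => h1 _ ρ.2.2⟩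
    rw [tsum_empty, tsum_empty]

theorem isCircuitQuantifying_qbar [MeasurableEq X] [Monoid Ω] {m : Ω → ℝ≥0∞} (hm : IsTracial m) :
    IsCircuitQuantifying 𝔪 (qbar (Ω := Ω) 𝔪 m) where
  rename_eq _ _ _ _ hπ hσ h := qbar_map_eq hm hπ hσ h
  rotation_eq := by
    rintro H π₁ _ h₁ h₂ ⟨i, rfl⟩
    rw [qbar_eq_rotSum hm H h₁, qbar_eq_rotSum hm H h₂, rotSum_rotate]
  refinement_invariant := isRefinementInvariant_qbar hm

end IGraphings

theorem mainTheorem2 {X : Type*} [TopologicalSpace X] [SecondCountableTopology X] [T2Space X]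
    [MeasurableSpace X] [BorelSpace X] (μ : Measure X) [IsLocallyFiniteMeasure μ]
    [μ.InnerRegular] {Ω : Type*} [Monoid Ω] (m : Ω → ℝ≥0∞) (hm : IGraphings.IsTracial m) :
    IGraphings.IsCircuitQuantifying (IGraphings.macrocosm μ)
      (IGraphings.qbar (Ω := Ω) (IGraphings.macrocosm μ) m) :=
  IGraphings.isCircuitQuantifying_qbar hm
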